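/- **Setting.** Let $\nu$ be the Wiener measure on $C([0,1])$, i.e. the measure under which the coordinate process is a centred Gaussian process with covariance $\min(s,t)$. Put $W=C([0,1])\oplus C([0,1])$ with the product measure $\mu=\nu\otimes\nu$, and $H=L^2([0,1])\oplus L^2([0,1])$, embedded in $W$ by $(h_1,h_2)\mapsto\left(\int_0^{\cdot}h_1(u)\,du,\int_0^{\cdot}h_2(u)\,du\right)$. A *smooth cylindrical functional* on $W$, with values in a normed space $E$, is a functional $w\mapsto f(\ell_1(w),\dots,\ell_n(w))$ with $\ell_k$ continuous linear functionals on $W$ and $f:\mathbb R^n\to E$ a $C^\infty$ map with polynomial growth of all its derivatives. Its derivative $\nabla^r\Phi(w)$ is the $r$-th derivative of $h\mapsto\Phi(w+h)$, $h\in H$, at $h=0$. For $E=\mathbb R$ it is measured in the Hilbert–Schmidt norm (the norm of the Hilbert tensor power of order $r$ of $H$); for $E$ the space of bounded bilinear forms on $H$, it is measured in the norm $\sup_{\|h\|,\|k\|\le1}\|\nabla^r\Phi(w)(h,k)\|_{HS}$. A functional belongs to *all the Sobolev spaces* if, for all $r\in\mathbb N$ and $1\le p<\infty$, it belongs to the completion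 of the smooth cylindrical functionals with respect to the norms $E[\|\nabla^j\Phi\|^p]^{1/p}$, $0\le j\le r$. Let $W_{\infty-}$ be the space of real functionals (up to almost sure equality) that belong to all the Sobolev spaces; $\nabla F=(\nabla_1F,\nabla_2F)$ is the $H$-valued derivative of $F\in W_{\infty-}$, obtained by closing $\nabla$. A bracket $\{\cdot,\cdot\}$ makes $W_{\infty-}$ a *Poisson Wiener space* if $W_{\infty-}$ is a commutative algebra (for the almost sure pointwise operations), $\{\cdot,\cdot\}$ is a Poisson bracket on it (an $\mathbb R$-bilinear map $W_{\infty-}\times W_{\infty-}\to W_{\infty-}$ that is antisymmetric and satisfies the Leibniz rule and the Jacobi identity), and there is a random bounded bilinear form $P$ on $H$, belonging to all the Sobolev spaces, with $\{F,G\}=P(\nabla F,\nabla G)$ almost surely for all $F,G\in W_{\infty-}$. **Theorem.** $\mu$ is the centred Gaussian measure on $W$ with Cameron–Martin space $H$ (so $H\subset W$ is a Wiener space), and $W_{\infty-}$ with the bracket $$\{F,G\}=\int_0^1\nabla_1F(s)\,\nabla_2G(s)\,ds-\int_0^1\nabla_1G(s)\,\nabla_2F(s)\,ds$$ is a Poisson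 Wiener space. -/

import Mathlib

open MeasureTheory ProbabilityTheory Filter Topology
open scoped ENNReal NNReal unitInterval

namespace WienerPoisson

noncomputable section

/-! ### The commutative algebra of random variables up to almost sure equality -/

section RandomVariables

variable {Ω : Type*} [MeasurableSpace Ω] {μ : Measure Ω}

instance instCommRingAEEqFun : CommRing (Ω →ₘ[μ] ℝ) :=
  { (inferInstance : AddCommGroup (Ω →ₘ[μ] ℝ)), (inferInstance : CommMonoid (Ω →ₘ[μ] ℝ)) with
    left_distrib := fun a b c => by
      refine AEEqFun.ext ?_
      filter_upwards [AEEqFun.coeFn_mul a (b + c), AEEqFun.coeFn_add b c,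
        AEEqFun.coeFn_add (a * b) (a * c), AEEqFun.coeFn_mul a b, AEEqFun.coeFn_mul a c]
        with w h1 h2 h3 h4 h5
      simp only [h1, h2, h3, h4, h5, Pi.add_apply, Pi.mul_apply, mul_add]
    right_distrib := fun a b c => by
      refine AEEqFun.ext ?_
      filter_upwards [AEEqFun.coeFn_mul (a + b) c, AEEqFun.coeFn_add a b,
        AEEqFun.coeFn_add (a * c) (b * c), AEEqFun.coeFn_mul a c, AEEqFun.coeFn_mul b c]
        with w h1 h2 h3 h4 h5
      simp only [h1, h2, h3, h4, h5, Pi.add_apply, Pi.mul_apply, add_mul]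
    zero_mul := fun a => by
      refine AEEqFun.ext ?_
      filter_upwards [AEEqFun.coeFn_mul (0 : Ω →ₘ[μ] ℝ) a,
        AEEqFun.coeFn_zero (α := Ω) (β := ℝ) (μ := μ)] with w h1 h2
      simp only [h1, h2, Pi.mul_apply, Pi.zero_apply, zero_mul]
    mul_zero := fun a => by
      refine AEEqFun.ext ?_
      filter_upwards [AEEqFun.coeFn_mul a (0 : Ω →ₘ[μ] ℝ),
        AEEqFun.coeFn_zero (α := Ω) (β := ℝ) (μ := μ)] with w h1 h2
      simp only [h1, h2, Pi.mul_apply, Pi.zero_apply, mul_zero] }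

instance instAlgebraAEEqFun : Algebra ℝ (Ω →ₘ[μ] ℝ) :=
  Algebra.ofModule
    (fun c a b => by
      refine AEEqFun.ext ?_
      filter_upwards [AEEqFun.coeFn_mul (c • a) b, AEEqFun.coeFn_smul c a,
        AEEqFun.coeFn_smul c (a * b), AEEqFun.coeFn_mul a b] with w h1 h2 h3 h4
      simp only [h1, h2, h3, h4, Pi.smul_apply, Pi.mul_apply, smul_eq_mul, mul_assoc])
    (fun c a b => by
      refine AEEqFun.ext ?_
      filter_upwards [AEEqFun.coeFn_mul a (c • b), AEEqFun.coeFn_smul c b,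
        AEEqFun.coeFn_smul c (a * b), AEEqFun.coeFn_mul a b] with w h1 h2 h3 h4
      simp only [h1, h2, h3, h4, Pi.smul_apply, Pi.mul_apply, smul_eq_mul, mul_left_comm])

end RandomVariables

/-! ### Malliavin Sobolev spaces over a Wiener space `i : H → W` with Gaussian measure `μ` -/

section Abstract

variable {H W E : Type*} [NormedAddCommGroup H] [InnerProductSpace ℝ H]
  [NormedAddCommGroup W] [NormedSpace ℝ W] [NormedAddCommGroup E] [NormedSpace ℝ E]

/-- `H` is embedded in `W` by `i` and `μ` is the associated Wiener measure: the centred Gaussian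
measure on `W` whose reproducing (Cameron--Martin) space is `H`, i.e. a continuous linear
functional `ℓ` on `W` is, under `μ`, a centred Gaussian variable with variance `‖ℓ ∘ i‖²`. -/
structure IsWienerSpace [MeasurableSpace W] (i : H →L[ℝ] W) (μ : Measure W) : Prop where
  isProbabilityMeasure : IsProbabilityMeasure μ
  injective : Function.Injective i
  charFunDual_eq : ∀ ℓ : StrongDual ℝ W,
    charFunDual μ ℓ = Complex.exp (-((‖ℓ ∘L i‖ : ℝ) : ℂ) ^ 2 / 2)

/-- Smooth cylindrical functionals `w ↦ f (ℓ₁ w, …, ℓₙ w)`, with `f` smooth and of polynomial growth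
together with all its derivatives, and `ℓ₁, …, ℓₙ` continuous linear functionals on `W`. -/
def IsSmoothCylindrical (Φ : W → E) : Prop :=
  ∃ (n : ℕ) (ℓ : Fin n → StrongDual ℝ W) (f : (Fin n → ℝ) → E),
    f.HasTemperateGrowth ∧ ∀ w, Φ w = f (fun k => ℓ k w)

/-- The `r`-th derivative of `Φ` at `w` in the directions of `H`, an `r`-linear map on `H`. -/
def cylDeriv (i : H →L[ℝ] W) (r : ℕ) (Φ : W → E) (w : W) :
    ContinuousMultilinearMap ℝ (fun _ : Fin r => H) E :=
  iteratedFDeriv ℝ r (fun h : H => Φ (w + i h)) 0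

/-- `Φ` is in the Sobolev spaces of all orders `r` and all exponents `1 ≤ p < ∞`: for each `(r, p)`
it lies in the completion of the smooth cylindrical functionals for the norms
`‖Φ‖_{j,p} = E[‖∇ʲ Φ‖ᵖ]^{1/p}`, `0 ≤ j ≤ r`. The parameter `N` is the norm used to measure the
`j`-linear maps `∇ʲ Φ (w)`. -/
def IsSobolev [MeasurableSpace W] (i : H →L[ℝ] W) (μ : Measure W)
    (N : ∀ j : ℕ, ((Fin j → H) → E) → ℝ≥0∞) (F : W → E) : Prop :=
  AEStronglyMeasurable F μ ∧
  ∀ (r : ℕ) (p : ℝ≥0), 1 ≤ p → ∃ Φ : ℕ → W → E,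
    (∀ n, IsSmoothCylindrical (Φ n)) ∧
    Tendsto (fun n => eLpNorm (Φ n - F) p μ) atTop (𝓝 0) ∧
    ∀ j ≤ r, Tendsto
      (fun mn : ℕ × ℕ =>
        ∫⁻ w, N j (fun x => cylDeriv i j (Φ mn.1 - Φ mn.2) w x) ^ (p : ℝ) ∂μ)
      atTop (𝓝 0)

variable [CompleteSpace H]

/-- The Hilbert--Schmidt norm of an `r`-linear form on the Hilbert space `H`, i.e. its norm in the
Hilbert tensor power of order `r` of `H` (it does not depend on the Hilbert basis used). -/
def hsNorm (r : ℕ) (T : (Fin r → H) → ℝ) : ℝ≥0∞ :=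
  (∑' J : Fin r → (exists_hilbertBasis ℝ H).choose,
    ‖T (fun k => (exists_hilbertBasis ℝ H).choose_spec.choose (J k))‖ₑ ^ 2) ^ (1 / 2 : ℝ)

/-- The norm of an `r`-linear map on `H` with values in the bounded bilinear forms on `H`: the
supremum over `‖h‖, ‖k‖ ≤ 1` of the Hilbert--Schmidt norm of its value at `(h, k)`. -/
def bilinNorm (r : ℕ) (T : (Fin r → H) → (H →L[ℝ] H →L[ℝ] ℝ)) : ℝ≥0∞ :=
  ⨆ (h : H) (k : H) (_ : ‖h‖ ≤ 1) (_ : ‖k‖ ≤ 1), hsNorm r (fun x => T x h k)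

/-- The real functionals that belong to all the Malliavin Sobolev spaces. -/
def MemWInfty [MeasurableSpace W] (i : H →L[ℝ] W) (μ : Measure W) (F : W → ℝ) : Prop :=
  IsSobolev i μ hsNorm F

/-- A random bounded bilinear form on `H` that belongs to all the Sobolev spaces. -/
def IsSobolevBilinForm [MeasurableSpace W] (i : H →L[ℝ] W) (μ : Measure W)
    (P : W → (H →L[ℝ] H →L[ℝ] ℝ)) : Prop :=
  IsSobolev i μ bilinNorm P

/-- `u` is the Malliavin derivative `∇F`, as an `H`-valued random variable: `(F, u)` is the limit
in `L²` of `(Φₙ, ∇Φₙ)` for smooth cylindrical functionals `Φₙ`. -/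
def IsMalliavinGradient [MeasurableSpace W] (i : H →L[ℝ] W) (μ : Measure W)
    (F : W → ℝ) (u : W → H) : Prop :=
  AEStronglyMeasurable u μ ∧ ∃ Φ : ℕ → W → ℝ,
    (∀ n, IsSmoothCylindrical (Φ n)) ∧
    Tendsto (fun n => eLpNorm (Φ n - F) 2 μ) atTop (𝓝 0) ∧
    Tendsto (fun n => eLpNorm
      (fun w => gradient (fun h : H => Φ n (w + i h)) 0 - u w) 2 μ) atTop (𝓝 0)

open Classical in
/-- The Malliavin derivative `∇F : W → H` (zero if `F` has none). -/
def malliavinGradient [MeasurableSpace W] (i : H →L[ℝ] W) (μ : Measure W)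
    (F : W → ℝ) : W → H :=
  if hF : ∃ u : W → H, IsMalliavinGradient i μ F u then hF.choose else 0

/-- A Poisson bracket on a commutative real algebra. -/
structure IsPoissonBracket {A : Type*} [CommRing A] [Algebra ℝ A]
    (B : A →ₗ[ℝ] A →ₗ[ℝ] A) : Prop where
  antisymm : ∀ F G, B F G = -B G F
  leibniz : ∀ F G K, B F (G * K) = B F G * K + G * B F K
  jacobi : ∀ F G K, B F (B G K) + B G (B K F) + B K (B F G) = 0

/-- `(W_{∞-}, br)` is a Poisson Wiener space. Functionals are taken up to almost sure equality;
`W_{∞-}` is an algebra, `br` takes its values in it and is a Poisson bracket on it, and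
`br F G = P (∇F, ∇G)` for a random bilinear form `P` that belongs to all the Sobolev spaces. -/
structure IsPoissonWienerSpace [MeasurableSpace W] (i : H →L[ℝ] W) (μ : Measure W)
    (br : (W → ℝ) → (W → ℝ) → W → ℝ) : Prop where
  isWienerSpace : IsWienerSpace i μ
  isPoisson : ∃ A : Subalgebra ℝ (W →ₘ[μ] ℝ), (∀ F : W →ₘ[μ] ℝ, F ∈ A ↔ MemWInfty i μ F) ∧
    ∃ B : A →ₗ[ℝ] A →ₗ[ℝ] A, IsPoissonBracket B ∧
      (∀ F G : A, (B F G : W →ₘ[μ] ℝ) =ᵐ[μ] br (F : W →ₘ[μ] ℝ) (G : W →ₘ[μ] ℝ)) ∧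
      ∃ P : W → (H →L[ℝ] H →L[ℝ] ℝ), IsSobolevBilinForm i μ P ∧
        ∀ F G : A, ∀ᵐ w ∂μ, br (F : W →ₘ[μ] ℝ) (G : W →ₘ[μ] ℝ) w =
          P w (malliavinGradient i μ (F : W →ₘ[μ] ℝ) w)
            (malliavinGradient i μ (G : W →ₘ[μ] ℝ) w)

end Abstract

/-! ### The product of two classical Wiener spaces -/

/-- `L²([0,1])`. -/
abbrev L2 : Type := Lp ℝ 2 (volume : Measure I)

/-- The Hilbert direct sum `L²([0,1]) ⊕ L²([0,1])`. -/
abbrev HH : Type := WithLp 2 (L2 × L2)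

/-- `C([0,1]) ⊕ C([0,1])`. -/
abbrev WW : Type := C(I, ℝ) × C(I, ℝ)

lemma integrable_L2 (h : L2) : Integrable h (volume : Measure I) :=
  (Lp.memLp h).integrable (by norm_num)

lemma continuous_primitive (h : L2) : Continuous fun t : I => ∫ u in Set.Iic t, h u := by
  have key : ∀ t : I, ∫ u in Set.Iic t, h u = ∫ u, (Set.Iic t).indicator h u := fun t =>
    (integral_indicator measurableSet_Iic).symm
  simp_rw [key]
  rw [continuous_iff_continuousAt]
  intro t₀
  refine continuousAt_of_dominated (bound := fun u => ‖h u‖) ?_ ?_ (integrable_L2 h).norm ?_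
  · exact Eventually.of_forall fun t =>
      (integrable_L2 h).aestronglyMeasurable.indicator measurableSet_Iic
  · exact Eventually.of_forall fun t => Eventually.of_forall fun u =>
      norm_indicator_le_norm_self _ _
  · have h0 : ∀ᵐ u : I, u ≠ t₀ := by simp [ae_iff]
    filter_upwards [h0] with u hu
    rcases lt_or_gt_of_ne hu with hlt | hgt
    · have : (fun t : I => (Set.Iic t).indicator h u) =ᶠ[𝓝 t₀] fun _ => h u := by
        filter_upwards [lt_mem_nhds hlt] with t ht
        simp [Set.indicator, ht.le]
      exact continuousAt_const.congr this.symm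
    · have : (fun t : I => (Set.Iic t).indicator h u) =ᶠ[𝓝 t₀] fun _ => 0 := by
        filter_upwards [gt_mem_nhds hgt] with t ht
        simp [Set.indicator, ht]
      exact continuousAt_const.congr this.symm

lemma norm_primitive_le (h : L2) (t : I) : ‖∫ u in Set.Iic t, h u‖ ≤ ‖h‖ := by
  have h1 : ‖∫ u in Set.Iic t, h u‖ ≤ ∫ u, ‖h u‖ :=
    (norm_integral_le_integral_norm _).trans
      (setIntegral_le_integral (integrable_L2 h).norm
        (Eventually.of_forall fun _ => norm_nonneg _))
  have h2 : ∫ u, ‖h u‖ = (eLpNorm h 1 volume).toReal := by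
    rw [eLpNorm_one_eq_lintegral_enorm,
      integral_norm_eq_lintegral_enorm (integrable_L2 h).aestronglyMeasurable]
  have h3 : eLpNorm h 1 (volume : Measure I) ≤ eLpNorm h 2 volume :=
    eLpNorm_le_eLpNorm_of_exponent_le (by norm_num) (Lp.aestronglyMeasurable h)
  rw [Lp.norm_def]
  exact h1.trans (h2 ▸ ENNReal.toReal_mono (Lp.eLpNorm_ne_top h) h3)

/-- The embedding of `L²([0,1])` in `C([0,1])` that sends `h` to `t ↦ ∫₀ᵗ h(u) du`. -/
def primitive : L2 →L[ℝ] C(I, ℝ) :=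
  LinearMap.mkContinuous
    { toFun := fun h => ⟨fun t => ∫ u in Set.Iic t, h u, continuous_primitive h⟩
      map_add' := fun h k => by
        ext t
        change ∫ u in Set.Iic t, (h + k) u = (∫ u in Set.Iic t, h u) + ∫ u in Set.Iic t, k u
        rw [← integral_add (integrable_L2 h).integrableOn (integrable_L2 k).integrableOn]
        exact integral_congr_ae (ae_restrict_of_ae (Lp.coeFn_add h k))
      map_smul' := fun c h => by
        ext t
        change ∫ u in Set.Iic t, (c • h) u = c • ∫ u in Set.Iic t, h u
        rw [← integral_smul]
        exact integral_congr_ae (ae_restrict_of_ae (Lp.coeFn_smul c h)) }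
    1 (fun h => by
      rw [one_mul, ContinuousMap.norm_le _ (norm_nonneg _)]
      exact norm_primitive_le h)

/-- The embedding `(h₁, h₂) ↦ (∫₀ᵗ h₁(u) du, ∫₀ᵗ h₂(u) du)` of the total Hilbert space. -/
def embed : HH →L[ℝ] WW :=
  (primitive ∘L WithLp.fstL 2 ℝ L2 L2).prod (primitive ∘L WithLp.sndL 2 ℝ L2 L2)

/-- `ν` is the Wiener measure on `C([0,1])`: under `ν` the coordinate process is a centred Gaussian
process with covariance `min s t`. -/
structure IsWienerMeasure [MeasurableSpace C(I, ℝ)] (ν : Measure C(I, ℝ)) : Prop where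
  isGaussianProcess : IsGaussianProcess (fun (t : I) (w : C(I, ℝ)) => w t) ν
  mean : ∀ t : I, ∫ w, w t ∂ν = 0
  covariance : ∀ s t : I, cov[fun w : C(I, ℝ) => w s, fun w => w t; ν] = min (s : ℝ) t

/-- The bracket `∫₀¹ ∇₁F(s) ∇₂G(s) ds - ∫₀¹ ∇₁G(s) ∇₂F(s) ds`, where `∇₁` and `∇₂` are the
components of the Malliavin derivative in the two copies of `L²([0,1])`. -/
def wienerBracket [MeasurableSpace C(I, ℝ)] (μ : Measure WW) (F G : WW → ℝ) (w : WW) : ℝ :=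
  (∫ s : I, (malliavinGradient embed μ F w).fst s * (malliavinGradient embed μ G w).snd s) -
    ∫ s : I, (malliavinGradient embed μ G w).fst s * (malliavinGradient embed μ F w).snd s

end

end WienerPoisson

/-! The bracket is P(∇F, ∇G) for a constant skew form P on H, the symplectic form pairing the two
copies of L². On smooth cylindrical functionals {Φ, ·} is differentiation along the vector field
that represents P(∇Φ, ·). Leibniz is then the product rule. Since P is constant, the Jacobi sum
contains only second derivatives of the three functionals, each occurring twice with opposite signs
(`cylBracket_jacobi`). What remains is to carry this calculus over to W_{∞-}, which works over any
Wiener space with H and W separable.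

The gradient must first be well defined on limits. Rotation invariance of μ ⊗ μ gives Gaussian
integration by parts (`IsWienerSpace.integral_fderiv_riesz`), which moves the derivative off a null
sequence. Together with the injectivity of characteristic functionals this yields closability
(`IsWienerSpace.ae_eq_zero_of_tendsto_cylGrad`). Hence the L^p limit of the gradients of any
approximating sequence is the Malliavin gradient almost surely
(`SobolevApprox.memLp_malliavinGradient`).

Next, W_{∞-} must be stable under product and bracket. Both are bilinear and obey the product rule,
so their Hilbert–Schmidt energies are bounded pointwise by products of energies of the arguments
(`IsDerivationPairing.totalEnergy_le`). By Cauchy–Schwarz, approximations of exponent 2p yield one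
of exponent p (`SobolevApprox.pairing_cauchy`). The bracket costs one derivative as well. Such
losses are harmless because all orders and exponents are available. The Poisson identities then pass
to the limit from cylindrical functionals.

Finally, ν ⊗ ν must be the Gaussian measure attached to H. For combinations of evaluations this is
the identity ⟨1_[0,s], 1_[0,t]⟩ = min(s, t). Bernstein polynomials approximate any functional by
such combinations (`IsWienerMeasure.charFunDual_eq`), and the product case follows by independence.
-/

namespace WienerPoisson

/-! ### Calculus of smooth cylindrical functionals. -/

section Cylindrical

variable {H W E F G : Type*} [NormedAddCommGroup H] [InnerProductSpace ℝ H]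
  [NormedAddCommGroup W] [NormedSpace ℝ W] [NormedAddCommGroup E] [NormedSpace ℝ E]
  [NormedAddCommGroup F] [NormedSpace ℝ F] [NormedAddCommGroup G] [NormedSpace ℝ G]

namespace IsSmoothCylindrical

theorem of_fintype {ι : Type*} [Fintype ι] (ℓ : ι → StrongDual ℝ W) {f : (ι → ℝ) → E}
    (hf : f.HasTemperateGrowth) : IsSmoothCylindrical fun w => f (fun k => ℓ k w) := by
  let e := Fintype.equivFin ι
  let L : (Fin (Fintype.card ι) → ℝ) →L[ℝ] (ι → ℝ) :=
    ContinuousLinearMap.pi fun k => ContinuousLinearMap.proj (e k)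
  refine ⟨Fintype.card ι, fun k => ℓ (e.symm k), f ∘ L, hf.comp L.hasTemperateGrowth, fun w => ?_⟩
  simp [L]

theorem const (c : E) : IsSmoothCylindrical fun _ : W => c :=
  of_fintype (W := W) (ι := Empty) (fun k => k.elim) (f := fun _ => c) (.const c)

theorem dual (ℓ : StrongDual ℝ W) : IsSmoothCylindrical fun w => ℓ w :=
  of_fintype (ι := Unit) (fun _ => ℓ) (f := fun x => x ())
    (ContinuousLinearMap.proj (R := ℝ) (φ := fun _ : Unit => ℝ) ()).hasTemperateGrowth

theorem comp_temperate {Φ : W → E} (hΦ : IsSmoothCylindrical Φ) {g : E → F}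
    (hg : g.HasTemperateGrowth) : IsSmoothCylindrical fun w => g (Φ w) := by
  obtain ⟨n, ℓ, f, hf, h⟩ := hΦ
  exact ⟨n, ℓ, g ∘ f, hg.comp hf, fun w => by simp [h]⟩

theorem clm {Φ : W → E} (hΦ : IsSmoothCylindrical Φ) (L : E →L[ℝ] F) :
    IsSmoothCylindrical fun w => L (Φ w) := hΦ.comp_temperate L.hasTemperateGrowth

theorem exists_common {Φ : W → E} {Ψ : W → F} (hΦ : IsSmoothCylindrical Φ)
    (hΨ : IsSmoothCylindrical Ψ) : ∃ (n m : ℕ) (ℓ : Fin n ⊕ Fin m → StrongDual ℝ W)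
      (f : (Fin n ⊕ Fin m → ℝ) → E) (g : (Fin n ⊕ Fin m → ℝ) → F), f.HasTemperateGrowth ∧
      g.HasTemperateGrowth ∧ (∀ w, Φ w = f fun k => ℓ k w) ∧ ∀ w, Ψ w = g fun k => ℓ k w := by
  obtain ⟨n, ℓ, f, hf, h⟩ := hΦ
  obtain ⟨m, ℓ', g, hg, h'⟩ := hΨ
  let L₁ : (Fin n ⊕ Fin m → ℝ) →L[ℝ] (Fin n → ℝ) :=
    ContinuousLinearMap.pi fun k => ContinuousLinearMap.proj (Sum.inl k)
  let L₂ : (Fin n ⊕ Fin m → ℝ) →L[ℝ] (Fin m → ℝ) :=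
    ContinuousLinearMap.pi fun k => ContinuousLinearMap.proj (Sum.inr k)
  exact ⟨n, m, Sum.elim ℓ ℓ', f ∘ L₁, g ∘ L₂, hf.comp L₁.hasTemperateGrowth,
    hg.comp L₂.hasTemperateGrowth, h, h'⟩

theorem bilin (B : E →L[ℝ] F →L[ℝ] G) {Φ : W → E} {Ψ : W → F} (hΦ : IsSmoothCylindrical Φ)
    (hΨ : IsSmoothCylindrical Ψ) : IsSmoothCylindrical fun w => B (Φ w) (Ψ w) := by
  obtain ⟨n, m, ℓ, f, g, hf, hg, h, h'⟩ := exists_common hΦ hΨ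
  simp_rw [h, h']
  exact of_fintype ℓ (B.bilinear_hasTemperateGrowth hf hg)

theorem add {Φ Ψ : W → E} (hΦ : IsSmoothCylindrical Φ) (hΨ : IsSmoothCylindrical Ψ) :
    IsSmoothCylindrical fun w => Φ w + Ψ w := by
  obtain ⟨n, m, ℓ, f, g, hf, hg, h, h'⟩ := exists_common hΦ hΨ
  simp_rw [h, h']
  exact of_fintype ℓ (hf.add hg)

theorem neg {Φ : W → E} (hΦ : IsSmoothCylindrical Φ) : IsSmoothCylindrical fun w => -Φ w :=
  hΦ.clm (-ContinuousLinearMap.id ℝ E)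

theorem const_smul (c : ℝ) {Φ : W → E} (hΦ : IsSmoothCylindrical Φ) :
    IsSmoothCylindrical fun w => c • Φ w :=
  hΦ.clm (c • ContinuousLinearMap.id ℝ E)

theorem sub {Φ Ψ : W → E} (hΦ : IsSmoothCylindrical Φ) (hΨ : IsSmoothCylindrical Ψ) :
    IsSmoothCylindrical fun w => Φ w - Ψ w := by
  simpa [sub_eq_add_neg] using hΦ.add hΨ.neg

theorem mul {Φ Ψ : W → ℝ} (hΦ : IsSmoothCylindrical Φ) (hΨ : IsSmoothCylindrical Ψ) :
    IsSmoothCylindrical fun w => Φ w * Ψ w :=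
  bilin (ContinuousLinearMap.mul ℝ ℝ) hΦ hΨ

theorem hasTemperateGrowth {Φ : W → E} (hΦ : IsSmoothCylindrical Φ) :
    Φ.HasTemperateGrowth := by
  obtain ⟨n, ℓ, f, hf, h⟩ := hΦ
  rw [funext h]
  exact hf.comp (ContinuousLinearMap.pi ℓ).hasTemperateGrowth

theorem contDiff {Φ : W → E} (hΦ : IsSmoothCylindrical Φ) : ContDiff ℝ (⊤ : ℕ∞) Φ :=
  hΦ.hasTemperateGrowth.1

theorem differentiable {Φ : W → E} (hΦ : IsSmoothCylindrical Φ) : Differentiable ℝ Φ :=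
  hΦ.contDiff.differentiable (by simp)

theorem continuous {Φ : W → E} (hΦ : IsSmoothCylindrical Φ) : Continuous Φ :=
  hΦ.contDiff.continuous

theorem fderiv_right {Φ : W → E} (hΦ : IsSmoothCylindrical Φ) :
    IsSmoothCylindrical (fderiv ℝ Φ) := by
  obtain ⟨n, ℓ, f, hf, h⟩ := hΦ
  let L := ContinuousLinearMap.pi ℓ
  have h1 : fderiv ℝ Φ = fun w =>
      (ContinuousLinearMap.compL ℝ W (Fin n → ℝ) E).flip L (fderiv ℝ f (fun k => ℓ k w)) := by
    ext1 w
    rw [funext h]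
    exact ((hf.1.differentiable (by simp) _).hasFDerivAt.comp w L.hasFDerivAt).fderiv
  rw [h1]
  refine clm (E := (Fin n → ℝ) →L[ℝ] E) (Φ := fun w => fderiv ℝ f fun k => ℓ k w) ?_ _
  refine ⟨n, ℓ, fderiv ℝ f, ⟨hf.1.fderiv_right (by simp), fun m => ?_⟩, fun w => rfl⟩
  simpa [norm_iteratedFDeriv_fderiv] using hf.2 (m + 1)

theorem fderiv_apply {Φ : W → E} (hΦ : IsSmoothCylindrical Φ) (v : W) :
    IsSmoothCylindrical fun w => fderiv ℝ Φ w v :=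
  hΦ.fderiv_right.clm (ContinuousLinearMap.apply ℝ E v)

end IsSmoothCylindrical

theorem isSmoothCylindrical_sum {ι : Type*} (s : Finset ι) {Φ : ι → W → E}
    (h : ∀ k ∈ s, IsSmoothCylindrical (Φ k)) : IsSmoothCylindrical fun w => ∑ k ∈ s, Φ k w := by
  classical
  induction s using Finset.induction_on with
  | empty => simpa using IsSmoothCylindrical.const (0 : E)
  | insert a s ha ih =>
    simp_rw [Finset.sum_insert ha]
    exact (h a (by simp)).add (ih fun k hk => h k (by simp [hk]))

/-- Separating the direction v from the point w through finitely many fixed functionals is what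
makes Hilbert–Schmidt sums over an infinite basis converge: only the coefficients `ℓ k v` vary with
the basis vector. -/
theorem IsSmoothCylindrical.exists_fderiv_eq_sum {Φ : W → ℝ} (hΦ : IsSmoothCylindrical Φ) :
    ∃ (n : ℕ) (ℓ : Fin n → StrongDual ℝ W) (g : Fin n → W → ℝ),
      (∀ k, IsSmoothCylindrical (g k)) ∧ ∀ w v, fderiv ℝ Φ w v = ∑ k, ℓ k v * g k w := by
  obtain ⟨n, ℓ, f, hf, h⟩ := hΦ
  let L := ContinuousLinearMap.pi ℓ
  refine ⟨n, ℓ, fun k w => fderiv ℝ f (fun j => ℓ j w) (Pi.single k 1), fun k => ?_, fun w v => ?_⟩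
  · have : IsSmoothCylindrical fun w => fderiv ℝ f fun j => ℓ j w := by
      refine ⟨n, ℓ, fderiv ℝ f, ⟨hf.1.fderiv_right (by simp), fun m => ?_⟩, fun w => rfl⟩
      simpa [norm_iteratedFDeriv_fderiv] using hf.2 (m + 1)
    exact this.clm (ContinuousLinearMap.apply ℝ ℝ (Pi.single k 1))
  · have h1 : fderiv ℝ Φ w = fderiv ℝ f (fun k => ℓ k w) ∘L L := by
      rw [funext h]
      exact ((hf.1.differentiable (by simp) _).hasFDerivAt.comp w L.hasFDerivAt).fderiv
    rw [h1, ContinuousLinearMap.comp_apply, ← ContinuousLinearMap.coe_coe,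
      LinearMap.pi_apply_eq_sum_univ]
    simp [L]
    congr! 3
    ext j
    simp [Pi.single_apply, eq_comm]

variable (i : H →L[ℝ] W)

theorem cylDeriv_zero_apply (Φ : W → E) (w : W) (x : Fin 0 → H) :
    cylDeriv i 0 Φ w x = Φ w := by
  simp [cylDeriv]

theorem fderiv_comp_add {Φ : W → E} (hΦ : IsSmoothCylindrical Φ) (w : W) (h : H) :
    fderiv ℝ (fun k : H => Φ (w + i k)) h = fderiv ℝ Φ (w + i h) ∘L i :=
  ((hΦ.differentiable (w + i h)).hasFDerivAt.comp h (i.hasFDerivAt.const_add w)).fderiv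

theorem contDiff_comp_add {Φ : W → E} (hΦ : IsSmoothCylindrical Φ) (w : W) :
    ContDiff ℝ (⊤ : ℕ∞) (fun k : H => Φ (w + i k)) :=
  hΦ.contDiff.comp (contDiff_const.add i.contDiff)

/-- Peeling off the last direction leaves a lower derivative of another cylindrical functional, so
induction on the order can stay within cylindrical functionals with values in E. -/
theorem cylDeriv_succ_apply {Φ : W → E} (hΦ : IsSmoothCylindrical Φ) (r : ℕ) (w : W)
    (x : Fin (r + 1) → H) : cylDeriv i (r + 1) Φ w x =
      cylDeriv i r (fun w => fderiv ℝ Φ w (i (x (Fin.last r)))) w (Fin.init x) := by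
  rw [cylDeriv, iteratedFDeriv_succ_apply_right, cylDeriv]
  have h1 : (fun h : H => fderiv ℝ Φ (w + i h) (i (x (Fin.last r)))) =
      ContinuousLinearMap.apply ℝ E (x (Fin.last r)) ∘ fderiv ℝ (fun k : H => Φ (w + i k)) := by
    ext h
    simp [fderiv_comp_add i hΦ]
  rw [h1, ContinuousLinearMap.iteratedFDeriv_comp_left _
    ((contDiff_comp_add i hΦ w).fderiv_right (m := r) (by norm_cast; simp)).contDiffAt le_rfl]
  rfl

end Cylindrical

/-! ### Polynomially bounded functions. -/

section PolyBounded

variable {W : Type*} [NormedAddCommGroup W]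

/-- A function with values in `[0, ∞]` that is bounded by a polynomial of the norm. -/
def PolyBounded (X : W → ℝ≥0∞) : Prop :=
  ∃ (C : ℝ≥0) (k : ℕ), ∀ w, X w ≤ C * (1 + ‖w‖ₑ) ^ k

namespace PolyBounded

theorem mono {X Y : W → ℝ≥0∞} (hY : PolyBounded Y) (h : ∀ w, X w ≤ Y w) : PolyBounded X := by
  obtain ⟨C, k, hC⟩ := hY
  exact ⟨C, k, fun w => (h w).trans (hC w)⟩

theorem const_mul {X : W → ℝ≥0∞} (hX : PolyBounded X) {c : ℝ≥0∞} (hc : c ≠ ∞) :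
    PolyBounded fun w => c * X w := by
  obtain ⟨C, k, hC⟩ := hX
  lift c to ℝ≥0 using hc
  refine ⟨c * C, k, fun w => ?_⟩
  rw [ENNReal.coe_mul, mul_assoc]
  exact mul_le_mul_right (hC w) _

theorem add {X Y : W → ℝ≥0∞} (hX : PolyBounded X) (hY : PolyBounded Y) :
    PolyBounded fun w => X w + Y w := by
  obtain ⟨C, k, hC⟩ := hX
  obtain ⟨D, l, hD⟩ := hY
  refine ⟨C + D, k + l, fun w => ?_⟩
  rw [ENNReal.coe_add, add_mul]
  have h1 : 1 ≤ 1 + ‖w‖ₑ := le_self_add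
  refine add_le_add ((hC w).trans ?_) ((hD w).trans ?_)
  · exact mul_le_mul_right (pow_le_pow_right₀ h1 (by lia)) _
  · exact mul_le_mul_right (pow_le_pow_right₀ h1 (by lia)) _

theorem sum {κ : Type*} (s : Finset κ) {X : κ → W → ℝ≥0∞} (hX : ∀ k ∈ s, PolyBounded (X k)) :
    PolyBounded fun w => ∑ k ∈ s, X k w := by
  classical
  induction s using Finset.induction_on with
  | empty => exact ⟨0, 0, by simp⟩
  | insert a s ha ih =>
    simp_rw [Finset.sum_insert ha]
    exact (hX a (by simp)).add (ih fun k hk => hX k (by simp [hk]))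

theorem pow {X : W → ℝ≥0∞} (hX : PolyBounded X) (n : ℕ) : PolyBounded fun w => X w ^ n := by
  obtain ⟨C, k, hC⟩ := hX
  refine ⟨C ^ n, k * n, fun w => ?_⟩
  rw [ENNReal.coe_pow, pow_mul, ← mul_pow]
  exact pow_le_pow_left' (hC w) n

end PolyBounded

theorem Function.HasTemperateGrowth.polyBounded [NormedSpace ℝ W] {E : Type*}
    [NormedAddCommGroup E] [NormedSpace ℝ E] {Φ : W → E} (hΦ : Φ.HasTemperateGrowth) : PolyBounded fun w => ‖Φ w‖ₑ := by
  obtain ⟨k, C, h⟩ := hΦ.2 0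
  refine ⟨C.toNNReal, k, fun w => ?_⟩
  have h1 := h w
  rw [norm_iteratedFDeriv_zero] at h1
  simp_rw [← ofReal_norm]
  refine (ENNReal.ofReal_le_ofReal h1).trans (le_of_eq ?_)
  rw [ENNReal.ofReal_mul' (by positivity), ENNReal.ofReal_pow (by positivity),
    ENNReal.ofReal_add (by simp) (by simp), ENNReal.ofReal_one]
  rfl

end PolyBounded

/-! ### Hilbert–Schmidt energies of derivatives, and product estimates. -/

section Energy

variable {H W ι : Type*} [NormedAddCommGroup H] [InnerProductSpace ℝ H]
  [NormedAddCommGroup W] [NormedSpace ℝ W]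

/-- The squared Hilbert--Schmidt norm of the `r`-th derivative of `Φ` along `H`. -/
noncomputable def energy (i : H →L[ℝ] W) (b : HilbertBasis ι ℝ H) : ℕ → (W → ℝ) → W → ℝ≥0∞
  | 0, Φ, w => ‖Φ w‖ₑ ^ 2
  | r + 1, Φ, w => ∑' e, energy i b r (fun w => fderiv ℝ Φ w (i (b e))) w

/-- The sum of the squared Hilbert--Schmidt norms of the derivatives of order at most `r`. -/
noncomputable def totalEnergy (i : H →L[ℝ] W) (b : HilbertBasis ι ℝ H) (r : ℕ) (Φ : W → ℝ)
    (w : W) : ℝ≥0∞ := ∑ j ∈ Finset.range (r + 1), energy i b j Φ w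

variable (i : H →L[ℝ] W) (b : HilbertBasis ι ℝ H)

theorem tsum_cylDeriv_eq_energy (r : ℕ) {Φ : W → ℝ} (hΦ : IsSmoothCylindrical Φ) (w : W) :
    ∑' J : Fin r → ι, ‖cylDeriv i r Φ w fun k => b (J k)‖ₑ ^ 2 = energy i b r Φ w := by
  induction r generalizing Φ with
  | zero =>
    simp [cylDeriv_zero_apply, energy]
  | succ r ih =>
    rw [← (Fin.snocEquiv fun _ : Fin (r + 1) => ι).tsum_eq, ENNReal.tsum_prod']
    simp_rw [energy, ← ih (hΦ.fderiv_apply _)]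
    congr! 7 with e J
    rw [cylDeriv_succ_apply i hΦ]
    congr 1
    · simp [Fin.snocEquiv]
    · ext k
      simp [Fin.snocEquiv, Fin.init]

theorem hsNorm_cylDeriv [CompleteSpace H] (r : ℕ) {Φ : W → ℝ} (hΦ : IsSmoothCylindrical Φ) (w : W) :
    hsNorm r (fun x => cylDeriv i r Φ w x) =
      energy i (exists_hilbertBasis ℝ H).choose_spec.choose r Φ w ^ (1 / 2 : ℝ) := by
  rw [← tsum_cylDeriv_eq_energy i _ r hΦ, hsNorm]

/-- Semicontinuity is the route to measurability: the basis is not assumed countable, and arbitrary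
sums of nonnegative lower semicontinuous functions remain lower semicontinuous. -/
theorem lowerSemicontinuous_energy (r : ℕ) {Φ : W → ℝ} (hΦ : IsSmoothCylindrical Φ) :
    LowerSemicontinuous (energy i b r Φ) := by
  induction r generalizing Φ with
  | zero =>
    exact ((ENNReal.continuous_pow 2).comp hΦ.continuous.enorm).lowerSemicontinuous
  | succ r ih => exact lowerSemicontinuous_tsum fun e => ih (hΦ.fderiv_apply _)

theorem measurable_energy [MeasurableSpace W] [BorelSpace W] (r : ℕ) {Φ : W → ℝ}
    (hΦ : IsSmoothCylindrical Φ) : Measurable (energy i b r Φ) :=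
  (lowerSemicontinuous_energy i b r hΦ).measurable

theorem measurable_totalEnergy [MeasurableSpace W] [BorelSpace W] (r : ℕ) {Φ : W → ℝ}
    (hΦ : IsSmoothCylindrical Φ) : Measurable (totalEnergy i b r Φ) :=
  Finset.measurable_sum _ fun j _ => measurable_energy i b j hΦ

theorem energy_le_totalEnergy {j r : ℕ} (hj : j ≤ r) (Φ : W → ℝ) (w : W) :
    energy i b j Φ w ≤ totalEnergy i b r Φ w :=
  Finset.single_le_sum (f := fun j => energy i b j Φ w) (fun _ _ => zero_le)
    (Finset.mem_range.2 (Nat.lt_succ_of_le hj))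

theorem totalEnergy_mono {j r : ℕ} (hj : j ≤ r) (Φ : W → ℝ) (w : W) :
    totalEnergy i b j Φ w ≤ totalEnergy i b r Φ w :=
  Finset.sum_le_sum_of_subset (Finset.range_mono (by lia))

theorem tsum_totalEnergy_le (r : ℕ) (Φ : W → ℝ) (w : W) :
    ∑' e, totalEnergy i b r (fun w => fderiv ℝ Φ w (i (b e))) w ≤ totalEnergy i b (r + 1) Φ w := by
  simp_rw [totalEnergy]
  rw [Summable.tsum_finsetSum fun _ _ => ENNReal.summable, Finset.sum_range_succ' _ (r + 1)]
  exact le_self_add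

theorem energy_const_smul (c : ℝ) (r : ℕ) {Φ : W → ℝ} (hΦ : IsSmoothCylindrical Φ) (w : W) :
    energy i b r (fun w => c * Φ w) w = ‖c‖ₑ ^ 2 * energy i b r Φ w := by
  induction r generalizing Φ with
  | zero => simp [energy, enorm_mul, mul_pow]
  | succ r ih =>
    simp_rw [energy, ← ENNReal.tsum_mul_left, ← ih (hΦ.fderiv_apply _)]
    congr! 4 with e w
    rw [fderiv_const_mul (hΦ.differentiable w)]
    simp

theorem enorm_add_sq_le {E : Type*} [NormedAddCommGroup E] (x y : E) :
    ‖x + y‖ₑ ^ 2 ≤ 2 * ‖x‖ₑ ^ 2 + 2 * ‖y‖ₑ ^ 2 := by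
  have h : ‖x + y‖ ^ 2 ≤ 2 * ‖x‖ ^ 2 + 2 * ‖y‖ ^ 2 := by
    nlinarith [norm_add_le x y, norm_nonneg (x + y), sq_nonneg (‖x‖ - ‖y‖), norm_nonneg x,
      norm_nonneg y]
  have h' : ‖x + y‖₊ ^ 2 ≤ 2 * ‖x‖₊ ^ 2 + 2 * ‖y‖₊ ^ 2 := by exact_mod_cast h
  simp_rw [enorm_eq_nnnorm]
  exact_mod_cast h'

theorem energy_add_le (r : ℕ) {Φ Ψ : W → ℝ} (hΦ : IsSmoothCylindrical Φ)
    (hΨ : IsSmoothCylindrical Ψ) (w : W) : energy i b r (fun w => Φ w + Ψ w) w ≤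
      2 * energy i b r Φ w + 2 * energy i b r Ψ w := by
  induction r generalizing Φ Ψ with
  | zero => exact enorm_add_sq_le _ _
  | succ r ih =>
    simp_rw [energy, ← ENNReal.tsum_mul_left, ← ENNReal.tsum_add]
    refine ENNReal.tsum_le_tsum fun e => ?_
    refine (le_of_eq ?_).trans (ih (hΦ.fderiv_apply _) (hΨ.fderiv_apply _))
    congr 1
    ext w
    rw [fderiv_fun_add (hΦ.differentiable w) (hΨ.differentiable w)]
    simp

theorem totalEnergy_add_le (r : ℕ) {Φ Ψ : W → ℝ} (hΦ : IsSmoothCylindrical Φ)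
    (hΨ : IsSmoothCylindrical Ψ) (w : W) : totalEnergy i b r (fun w => Φ w + Ψ w) w ≤
      2 * totalEnergy i b r Φ w + 2 * totalEnergy i b r Ψ w := by
  simp_rw [totalEnergy, Finset.mul_sum, ← Finset.sum_add_distrib]
  exact Finset.sum_le_sum fun j _ => energy_add_le i b j hΦ hΨ w

theorem totalEnergy_const_smul (c : ℝ) (r : ℕ) {Φ : W → ℝ} (hΦ : IsSmoothCylindrical Φ) (w : W) :
    totalEnergy i b r (fun w => c * Φ w) w = ‖c‖ₑ ^ 2 * totalEnergy i b r Φ w := by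
  simp_rw [totalEnergy, Finset.mul_sum, energy_const_smul i b c _ hΦ]

/-- The crude factor `2 ^ s.card` comes from iterating the two-term estimate; only its finiteness
matters. -/
theorem energy_sum_le {κ : Type*} (s : Finset κ) (r : ℕ) {Φ : κ → W → ℝ}
    (hΦ : ∀ k, IsSmoothCylindrical (Φ k)) (w : W) :
    energy i b r (fun w => ∑ k ∈ s, Φ k w) w ≤ 2 ^ s.card * ∑ k ∈ s, energy i b r (Φ k) w := by
  classical
  induction s using Finset.induction_on with
  | empty =>
    have : energy i b r (fun _ => (0 : ℝ)) w = 0 := by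
      simpa using energy_const_smul i b 0 r (IsSmoothCylindrical.const (0 : ℝ)) w
    simp [this]
  | insert a s ha ih =>
    simp_rw [Finset.sum_insert ha, Finset.card_insert_of_notMem ha]
    refine (energy_add_le i b r (hΦ a) (isSmoothCylindrical_sum s fun k _ => hΦ k) w).trans ?_
    rw [mul_add]
    gcongr ?_ + ?_
    · gcongr
      exact le_self_pow₀ one_le_two (by simp)
    · rw [pow_succ', mul_assoc]
      gcongr

/-- Parseval's identity for the Riesz representative of ℓ. -/
theorem tsum_enorm_sq_dual [CompleteSpace H] (ℓ : StrongDual ℝ H) :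
    ∑' e, ‖ℓ (b e)‖ₑ ^ 2 = ‖ℓ‖ₑ ^ 2 := by
  set x := (InnerProductSpace.toDual ℝ H).symm ℓ
  have hx : ∀ y, ℓ y = inner ℝ x y := fun y => by simp [x]
  have hn : ‖ℓ‖ = ‖x‖ := by simp [x]
  have h1 := b.hasSum_inner_mul_inner x x
  have h2 : HasSum (fun e => ‖ℓ (b e)‖ ^ 2) (‖ℓ‖ ^ 2) := by
    rw [hn, ← real_inner_self_eq_norm_sq]
    refine h1.congr_fun fun e => ?_
    rw [hx, real_inner_comm x, Real.norm_eq_abs, sq_abs, sq]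
  have h3 := ENNReal.ofReal_tsum_of_nonneg (fun e => by positivity) h2.summable
  rw [h2.tsum_eq] at h3
  simpa only [ENNReal.ofReal_pow (norm_nonneg _), ofReal_norm] using h3.symm

/-- The derivative is a finite sum of terms `ℓ k v * g k w`. Summing over the basis turns the
coefficients into the finite numbers `‖ℓ k ∘L i‖ₑ ^ 2`, leaving lower energies of the cylindrical `g
k`. -/
theorem polyBounded_energy [CompleteSpace H] (r : ℕ) {Φ : W → ℝ} (hΦ : IsSmoothCylindrical Φ) :
    PolyBounded (energy i b r Φ) := by
  induction r generalizing Φ with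
  | zero => exact (Function.HasTemperateGrowth.polyBounded hΦ.hasTemperateGrowth).pow 2
  | succ r ih =>
    obtain ⟨n, ℓ, g, hg, h⟩ := hΦ.exists_fderiv_eq_sum
    have : PolyBounded fun w => 2 ^ n * ∑ k, ‖ℓ k ∘L i‖ₑ ^ 2 * energy i b r (g k) w :=
      (PolyBounded.sum _ fun k _ => (ih (hg k)).const_mul (by simp)).const_mul (by simp)
    refine this.mono fun w => ?_
    simp_rw [energy, h]
    calc ∑' e, energy i b r (fun w => ∑ k, ℓ k (i (b e)) * g k w) w
        ≤ ∑' e, 2 ^ n * ∑ k, ‖ℓ k (i (b e))‖ₑ ^ 2 * energy i b r (g k) w := by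
          refine ENNReal.tsum_le_tsum fun e => ?_
          refine (energy_sum_le i b Finset.univ r (fun k => (hg k).const_smul (ℓ k (i (b e))))
            w).trans ?_
          simp [energy_const_smul i b _ r (hg _)]
      _ = _ := by
          rw [ENNReal.tsum_mul_left, Summable.tsum_finsetSum fun _ _ => ENNReal.summable]
          simp_rw [ENNReal.tsum_mul_right, ← tsum_enorm_sq_dual b]
          rfl

theorem polyBounded_totalEnergy [CompleteSpace H] (r : ℕ) {Φ : W → ℝ}
    (hΦ : IsSmoothCylindrical Φ) : PolyBounded (totalEnergy i b r Φ) :=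
  PolyBounded.sum _ fun j _ => polyBounded_energy i b j hΦ

/-- A bilinear operation on smooth cylindrical functionals that obeys the product rule and depends
on the derivatives of order at most `s`. -/
structure IsDerivationPairing (s : ℕ) (C : ℝ≥0∞) (β : (W → ℝ) → (W → ℝ) → W → ℝ) : Prop where
  isSmoothCylindrical : ∀ {Φ Ψ : W → ℝ}, IsSmoothCylindrical Φ → IsSmoothCylindrical Ψ →
    IsSmoothCylindrical (β Φ Ψ)
  fderiv_apply : ∀ {Φ Ψ : W → ℝ}, IsSmoothCylindrical Φ → IsSmoothCylindrical Ψ → ∀ w v,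
    fderiv ℝ (β Φ Ψ) w v = β (fun w => fderiv ℝ Φ w v) Ψ w + β Φ (fun w => fderiv ℝ Ψ w v) w
  sub_left : ∀ {Φ Φ' Ψ : W → ℝ}, IsSmoothCylindrical Φ → IsSmoothCylindrical Φ' →
    ∀ w, β (fun w => Φ w - Φ' w) Ψ w = β Φ Ψ w - β Φ' Ψ w
  sub_right : ∀ {Φ Ψ Ψ' : W → ℝ}, IsSmoothCylindrical Ψ → IsSmoothCylindrical Ψ' →
    ∀ w, β Φ (fun w => Ψ w - Ψ' w) w = β Φ Ψ w - β Φ Ψ' w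
  enorm_le : ∀ {Φ Ψ : W → ℝ}, IsSmoothCylindrical Φ → IsSmoothCylindrical Ψ → ∀ w,
    ‖β Φ Ψ w‖ₑ ^ 2 ≤ C * totalEnergy i b s Φ w * totalEnergy i b s Ψ w

variable {i b}

/-- Each derivative falls on one of the two arguments, and the basis sum is absorbed by
`tsum_totalEnergy_le` in that argument. The inequality |x + y|² ≤ 2|x|² + 2|y|² applied to the two
terms costs a factor 4 per order. -/
theorem IsDerivationPairing.energy_le {s : ℕ} {C : ℝ≥0∞} {β : (W → ℝ) → (W → ℝ) → W → ℝ}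
    (hβ : IsDerivationPairing i b s C β) (r : ℕ) {Φ Ψ : W → ℝ} (hΦ : IsSmoothCylindrical Φ)
    (hΨ : IsSmoothCylindrical Ψ) (w : W) : energy i b r (β Φ Ψ) w ≤
      4 ^ r * C * totalEnergy i b (r + s) Φ w * totalEnergy i b (r + s) Ψ w := by
  induction r generalizing Φ Ψ with
  | zero => simpa [energy] using hβ.enorm_le hΦ hΨ w
  | succ r ih =>
    have h2 : ∀ Φ : W → ℝ, totalEnergy i b (r + s) Φ w ≤ totalEnergy i b (r + 1 + s) Φ w :=
      fun Φ => totalEnergy_mono i b (by lia) Φ w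
    have h1 : ∀ Φ : W → ℝ, ∑' e, totalEnergy i b (r + s) (fun w => fderiv ℝ Φ w (i (b e))) w ≤
        totalEnergy i b (r + 1 + s) Φ w := fun Φ => by
      rw [show r + 1 + s = r + s + 1 by lia]
      exact tsum_totalEnergy_le i b (r + s) Φ w
    calc energy i b (r + 1) (β Φ Ψ) w
        ≤ ∑' e, (2 * (4 ^ r * C * totalEnergy i b (r + s) (fun w => fderiv ℝ Φ w (i (b e))) w *
              totalEnergy i b (r + s) Ψ w) + 2 * (4 ^ r * C * totalEnergy i b (r + s) Φ w *
              totalEnergy i b (r + s) (fun w => fderiv ℝ Ψ w (i (b e))) w)) := by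
          refine ENNReal.tsum_le_tsum fun e => ?_
          rw [funext fun w => hβ.fderiv_apply hΦ hΨ w (i (b e))]
          refine (energy_add_le i b r (hβ.isSmoothCylindrical (hΦ.fderiv_apply _) hΨ)
            (hβ.isSmoothCylindrical hΦ (hΨ.fderiv_apply _)) w).trans ?_
          gcongr
          · exact ih (hΦ.fderiv_apply _) hΨ
          · exact ih hΦ (hΨ.fderiv_apply _)
      _ = 2 * (4 ^ r * C * (∑' e, totalEnergy i b (r + s) (fun w => fderiv ℝ Φ w (i (b e))) w) *
              totalEnergy i b (r + s) Ψ w) + 2 * (4 ^ r * C * totalEnergy i b (r + s) Φ w *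
              ∑' e, totalEnergy i b (r + s) (fun w => fderiv ℝ Ψ w (i (b e))) w) := by
          rw [ENNReal.tsum_add, ENNReal.tsum_mul_left, ENNReal.tsum_mul_left,
            ENNReal.tsum_mul_right, ENNReal.tsum_mul_left, ENNReal.tsum_mul_left]
      _ ≤ 2 * (4 ^ r * C * totalEnergy i b (r + 1 + s) Φ w * totalEnergy i b (r + 1 + s) Ψ w) +
            2 * (4 ^ r * C * totalEnergy i b (r + 1 + s) Φ w *
              totalEnergy i b (r + 1 + s) Ψ w) := by
          gcongr
          exacts [h1 Φ, h2 Ψ, h2 Φ, h1 Ψ]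
      _ = _ := by rw [pow_succ]; ring

theorem IsDerivationPairing.totalEnergy_le {s : ℕ} {C : ℝ≥0∞} {β : (W → ℝ) → (W → ℝ) → W → ℝ}
    (hβ : IsDerivationPairing i b s C β) (r : ℕ) {Φ Ψ : W → ℝ} (hΦ : IsSmoothCylindrical Φ)
    (hΨ : IsSmoothCylindrical Ψ) (w : W) : totalEnergy i b r (β Φ Ψ) w ≤
      (r + 1) * 4 ^ r * C * totalEnergy i b (r + s) Φ w * totalEnergy i b (r + s) Ψ w := by
  calc totalEnergy i b r (β Φ Ψ) w
      ≤ ∑ j ∈ Finset.range (r + 1),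
        4 ^ r * C * totalEnergy i b (r + s) Φ w * totalEnergy i b (r + s) Ψ w := by
        refine Finset.sum_le_sum fun j hj => (hβ.energy_le j hΦ hΨ w).trans ?_
        have hj : j ≤ r := by simpa [Nat.lt_succ_iff] using hj
        gcongr ?_ * _ * ?_ * ?_
        · gcongr
          norm_num
        · exact totalEnergy_mono i b (by lia) Φ w
        · exact totalEnergy_mono i b (by lia) Ψ w
    _ = _ := by
      rw [Finset.sum_const, Finset.card_range, nsmul_eq_mul]
      push_cast
      ring

end Energy

/-! ### Gradients along H and the bracket of cylindrical functionals. -/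

section Gradient

variable {H W ι : Type*} [NormedAddCommGroup H] [InnerProductSpace ℝ H] [CompleteSpace H]
  [NormedAddCommGroup W] [NormedSpace ℝ W]

/-- The vector of `H` that represents the restriction to `H` of a functional on `W`. -/
noncomputable def riesz (i : H →L[ℝ] W) : StrongDual ℝ W →L[ℝ] H :=
  LinearMap.mkContinuous
    { toFun := fun ℓ => (InnerProductSpace.toDual ℝ H).symm (ℓ ∘L i)
      map_add' := fun ℓ m => by rw [ContinuousLinearMap.add_comp, map_add]
      map_smul' := fun c ℓ => by rw [ContinuousLinearMap.smul_comp]; simp }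
    ‖i‖ fun ℓ => by simpa [mul_comm] using ContinuousLinearMap.opNorm_comp_le ℓ i

variable (i : H →L[ℝ] W)

@[simp]
theorem inner_riesz (ℓ : StrongDual ℝ W) (h : H) : inner ℝ (riesz i ℓ) h = ℓ (i h) := by
  simp [riesz]

@[simp]
theorem norm_riesz (ℓ : StrongDual ℝ W) : ‖riesz i ℓ‖ = ‖ℓ ∘L i‖ := by
  simp [riesz]

/-- The gradient of a smooth functional in the directions of `H`. -/
noncomputable def cylGrad (Φ : W → ℝ) (w : W) : H := riesz i (fderiv ℝ Φ w)

theorem inner_cylGrad (Φ : W → ℝ) (w : W) (h : H) :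
    inner ℝ (cylGrad i Φ w) h = fderiv ℝ Φ w (i h) := by
  simp [cylGrad]

theorem gradient_eq_cylGrad {Φ : W → ℝ} (hΦ : IsSmoothCylindrical Φ) (w : W) :
    gradient (fun h : H => Φ (w + i h)) 0 = cylGrad i Φ w := by
  rw [gradient, fderiv_comp_add i hΦ]
  simp [cylGrad, riesz]

theorem IsSmoothCylindrical.cylGrad {Φ : W → ℝ} (hΦ : IsSmoothCylindrical Φ) :
    IsSmoothCylindrical (cylGrad i Φ) :=
  hΦ.fderiv_right.clm (riesz i)

theorem energy_one (b : HilbertBasis ι ℝ H) (Φ : W → ℝ) (w : W) :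
    energy i b 1 Φ w = ‖cylGrad i Φ w‖ₑ ^ 2 := by
  have h := tsum_enorm_sq_dual b (fderiv ℝ Φ w ∘L i)
  have h1 : ‖cylGrad i Φ w‖ₑ = ‖fderiv ℝ Φ w ∘L i‖ₑ := by
    simp_rw [← ofReal_norm, WienerPoisson.cylGrad, norm_riesz]
  rw [h1, ← h]
  rfl

theorem fderiv_fderiv_apply_comm {Φ : W → ℝ} (hΦ : IsSmoothCylindrical Φ) (w u v : W) :
    fderiv ℝ (fun w => fderiv ℝ Φ w u) w v = fderiv ℝ (fderiv ℝ Φ) w v u := by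
  rw [fderiv_clm_apply (hΦ.fderiv_right.differentiable w) (differentiableAt_const u)]
  simp

theorem fderiv_fderiv_symm {Φ : W → ℝ} (hΦ : IsSmoothCylindrical Φ) (w u v : W) :
    fderiv ℝ (fderiv ℝ Φ) w u v = fderiv ℝ (fderiv ℝ Φ) w v u :=
  (hΦ.contDiff.contDiffAt.isSymmSndFDerivAt (by simpa using
    (WithTop.coe_le_coe.2 le_top : ((2 : ℕ∞) : WithTop ℕ∞) ≤ ((⊤ : ℕ∞) : WithTop ℕ∞)))).eq u v

/-- Symmetry of the second derivative lets the gradient commute with directional derivatives; this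
is what gives the bracket its product rule. -/
theorem fderiv_cylGrad_apply {Φ : W → ℝ} (hΦ : IsSmoothCylindrical Φ) (w v : W) :
    fderiv ℝ (cylGrad i Φ) w v = cylGrad i (fun w => fderiv ℝ Φ w v) w := by
  have h1 : fderiv ℝ (cylGrad i Φ) w = riesz i ∘L fderiv ℝ (fderiv ℝ Φ) w :=
    ((riesz i).hasFDerivAt.comp w (hΦ.fderiv_right.differentiable w).hasFDerivAt).fderiv
  rw [h1, ContinuousLinearMap.comp_apply, cylGrad]
  congr 1
  ext u
  rw [fderiv_fderiv_apply_comm hΦ, fderiv_fderiv_symm hΦ]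

theorem cylGrad_sub {Φ Ψ : W → ℝ} (hΦ : IsSmoothCylindrical Φ) (hΨ : IsSmoothCylindrical Ψ)
    (w : W) : cylGrad i (fun w => Φ w - Ψ w) w = cylGrad i Φ w - cylGrad i Ψ w := by
  rw [cylGrad, fderiv_fun_sub (hΦ.differentiable w) (hΨ.differentiable w), map_sub]
  rfl

theorem cylGrad_add {Φ Ψ : W → ℝ} (hΦ : IsSmoothCylindrical Φ) (hΨ : IsSmoothCylindrical Ψ)
    (w : W) : cylGrad i (fun w => Φ w + Ψ w) w = cylGrad i Φ w + cylGrad i Ψ w := by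
  rw [cylGrad, fderiv_fun_add (hΦ.differentiable w) (hΨ.differentiable w), map_add]
  rfl

theorem cylGrad_mul {Φ Ψ : W → ℝ} (hΦ : IsSmoothCylindrical Φ) (hΨ : IsSmoothCylindrical Ψ)
    (w : W) : cylGrad i (fun w => Φ w * Ψ w) w = Φ w • cylGrad i Ψ w + Ψ w • cylGrad i Φ w := by
  rw [cylGrad, fderiv_fun_mul (hΦ.differentiable w) (hΨ.differentiable w), map_add, map_smul,
    map_smul]
  rfl

/-- The bracket of smooth functionals given by a bilinear form on `H`. -/
noncomputable def cylBracket (P : H →L[ℝ] H →L[ℝ] ℝ) (Φ Ψ : W → ℝ) (w : W) : ℝ :=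
  P (cylGrad i Φ w) (cylGrad i Ψ w)

omit [CompleteSpace H] in
theorem isDerivationPairing_mul (b : HilbertBasis ι ℝ H) :
    IsDerivationPairing i b 0 1 fun (Φ Ψ : W → ℝ) w => Φ w * Ψ w where
  isSmoothCylindrical hΦ hΨ := hΦ.mul hΨ
  fderiv_apply {Φ Ψ} hΦ hΨ w v := by
    rw [fderiv_fun_mul (hΦ.differentiable w) (hΨ.differentiable w)]
    simp
    ring
  sub_left _ _ w := sub_mul _ _ _
  sub_right _ _ w := mul_sub _ _ _
  enorm_le _ _ w := by simp [totalEnergy, energy, enorm_mul, mul_pow]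

variable (P : H →L[ℝ] H →L[ℝ] ℝ)

/-- Since P does not depend on w, differentiating the bracket produces no term in ∇P. The pairing
has order 1 because the energy of order 1 is the squared norm of the gradient. -/
theorem isDerivationPairing_cylBracket (b : HilbertBasis ι ℝ H) :
    IsDerivationPairing i b 1 (‖P‖ₑ ^ 2) (cylBracket i P) where
  isSmoothCylindrical hΦ hΨ := IsSmoothCylindrical.bilin P (hΦ.cylGrad i) (hΨ.cylGrad i)
  fderiv_apply {Φ Ψ} hΦ hΨ w v := by
    have h := (P.hasFDerivAt_of_bilinear ((hΦ.cylGrad i).differentiable w).hasFDerivAt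
      ((hΨ.cylGrad i).differentiable w).hasFDerivAt).fderiv
    change fderiv ℝ (fun y => P (cylGrad i Φ y) (cylGrad i Ψ y)) w v = _
    rw [h]
    simp [fderiv_cylGrad_apply i hΦ, fderiv_cylGrad_apply i hΨ, cylBracket, add_comm]
  sub_left hΦ hΦ' w := by simp [cylBracket, cylGrad_sub i hΦ hΦ']
  sub_right hΨ hΨ' w := by simp [cylBracket, cylGrad_sub i hΨ hΨ']
  enorm_le {Φ Ψ} hΦ hΨ w := by
    have h1 : ‖cylBracket i P Φ Ψ w‖ₑ ≤ ‖P‖ₑ * ‖cylGrad i Φ w‖ₑ * ‖cylGrad i Ψ w‖ₑ := by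
      simp_rw [enorm_eq_nnnorm]
      exact_mod_cast P.le_opNorm₂ (cylGrad i Φ w) (cylGrad i Ψ w)
    refine (pow_le_pow_left' h1 2).trans ?_
    rw [mul_pow, mul_pow, ← energy_one i b, ← energy_one i b]
    gcongr <;> exact energy_le_totalEnergy i b le_rfl _ _

variable {P}

/-- Here `a Φ` is the Hamiltonian vector of Φ at the fixed point w, so that {Φ, G}(w) is the
derivative of G along `a Φ`. Applied to G = {Ψ, X}, the product rule puts the second derivative on Ψ
or on X, and skewness turns the first of these terms into the one with a minus sign. -/
theorem cylBracket_cylBracket (hP : ∀ h k, P h k = -P k h) {Φ Ψ X : W → ℝ}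
    (hΨ : IsSmoothCylindrical Ψ) (hX : IsSmoothCylindrical X) (w : W) :
    let a : (W → ℝ) → W := fun Φ => i ((InnerProductSpace.toDual ℝ H).symm (P (cylGrad i Φ w)))
    cylBracket i P Φ (cylBracket i P Ψ X) w =
      fderiv ℝ (fderiv ℝ X) w (a Φ) (a Ψ) - fderiv ℝ (fderiv ℝ Ψ) w (a Φ) (a X) := by
  intro a
  have key : ∀ (F G : W → ℝ), P (cylGrad i F w) (cylGrad i G w) = fderiv ℝ G w (a F) :=
    fun F G => by
      rw [← inner_cylGrad, real_inner_comm, InnerProductSpace.toDual_symm_apply]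
  have h1 : cylBracket i P Φ (cylBracket i P Ψ X) w =
      fderiv ℝ (cylBracket i P Ψ X) w (a Φ) := key _ _
  obtain ⟨ι, b, -⟩ := exists_hilbertBasis ℝ H
  rw [h1, (isDerivationPairing_cylBracket i P b).fderiv_apply hΨ hX, cylBracket, cylBracket, hP,
    key, key, fderiv_fderiv_apply_comm hΨ, fderiv_fderiv_apply_comm hX,
    fderiv_fderiv_symm hΨ w (a X), fderiv_fderiv_symm hX w (a Ψ)]
  ring

/-- In the cyclic sum the Hessian of each functional, evaluated on the Hamiltonian vectors of the
other two, appears once with each sign; symmetry of the Hessians makes the sum vanish. -/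
theorem cylBracket_jacobi (hP : ∀ h k, P h k = -P k h) {Φ Ψ X : W → ℝ}
    (hΦ : IsSmoothCylindrical Φ) (hΨ : IsSmoothCylindrical Ψ) (hX : IsSmoothCylindrical X) (w : W) :
    cylBracket i P Φ (cylBracket i P Ψ X) w + cylBracket i P Ψ (cylBracket i P X Φ) w +
      cylBracket i P X (cylBracket i P Φ Ψ) w = 0 := by
  rw [cylBracket_cylBracket i hP hΨ hX, cylBracket_cylBracket i hP hX hΦ,
    cylBracket_cylBracket i hP hΦ hΨ]
  dsimp only
  rw [fderiv_fderiv_symm hX, fderiv_fderiv_symm hΨ, fderiv_fderiv_symm hΦ]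
  ring

end Gradient

/-! ### Finite moments under a Gaussian measure. -/

section Moments

variable {W E : Type*} [NormedAddCommGroup W] [NormedSpace ℝ W] [CompleteSpace W]
  [SecondCountableTopology W] [MeasurableSpace W] [BorelSpace W] [NormedAddCommGroup E]
  {μ : Measure W} [IsGaussian μ]

theorem memLp_one_add_norm {p : ℝ≥0∞} (hp : p ≠ ∞) : MemLp (fun w : W => 1 + ‖w‖) p μ :=
  (memLp_const (1 : ℝ)).add (IsGaussian.memLp_id μ p hp).norm

/-- The norm has moments of every finite order under a Gaussian measure (`IsGaussian.memLp_id`), so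
polynomial growth is integrable to any power. -/
theorem PolyBounded.lintegral_rpow_lt_top {X : W → ℝ≥0∞} (hX : PolyBounded X) {q : ℝ}
    (hq : 0 ≤ q) : ∫⁻ w, X w ^ q ∂μ < ∞ := by
  obtain ⟨C, k, hC⟩ := hX
  -- The extra 1 in the exponent keeps it positive when `k * q = 0`, as the passage to an L^p norm
  -- requires.
  have h1 : ∀ w, X w ^ q ≤ (C : ℝ≥0∞) ^ q * ‖1 + ‖w‖‖ₑ ^ (k * q + 1) := fun w => by
    have he : ‖1 + ‖w‖‖ₑ = 1 + ‖w‖ₑ := by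
      rw [← ofReal_norm, ← ofReal_norm, Real.norm_of_nonneg (by positivity),
        ENNReal.ofReal_add (by simp) (by simp), ENNReal.ofReal_one]
    rw [he]
    calc X w ^ q ≤ (C * (1 + ‖w‖ₑ) ^ k) ^ q := ENNReal.rpow_le_rpow (hC w) hq
      _ = (C : ℝ≥0∞) ^ q * (1 + ‖w‖ₑ) ^ (k * q) := by
        rw [ENNReal.mul_rpow_of_nonneg _ _ hq, ← ENNReal.rpow_natCast, ← ENNReal.rpow_mul]
      _ ≤ _ := by
        gcongr
        · exact le_self_add
        · simp
  refine (lintegral_mono h1).trans_lt ?_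
  rw [lintegral_const_mul' _ _ (ENNReal.rpow_ne_top_of_nonneg hq (by simp))]
  refine ENNReal.mul_lt_top (ENNReal.rpow_lt_top_of_nonneg hq (by simp)) ?_
  have hpos : 0 < k * q + 1 := by positivity
  have h2 := (memLp_one_add_norm (μ := μ) (p := ENNReal.ofReal (k * q + 1)) (by simp)).2
  have h3 := lintegral_rpow_enorm_lt_top_of_eLpNorm_lt_top (by simpa using hpos) (by simp) h2
  rwa [ENNReal.toReal_ofReal hpos.le] at h3

theorem memLp_of_polyBounded {f : W → E} (hf : AEStronglyMeasurable f μ)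
    (hb : PolyBounded fun w => ‖f w‖ₑ) {p : ℝ≥0∞} (hp : p ≠ ∞) : MemLp f p μ := by
  refine ⟨hf, ?_⟩
  rcases eq_or_ne p 0 with rfl | h0
  · simp
  · exact (eLpNorm_lt_top_iff_lintegral_rpow_enorm_lt_top h0 hp).2
      (hb.lintegral_rpow_lt_top ENNReal.toReal_nonneg)

theorem IsSmoothCylindrical.memLp [NormedSpace ℝ E] {Φ : W → E} (hΦ : IsSmoothCylindrical Φ) {p : ℝ≥0∞}
    (hp : p ≠ ∞) : MemLp Φ p μ :=
  memLp_of_polyBounded hΦ.continuous.aestronglyMeasurable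
    (Function.HasTemperateGrowth.polyBounded hΦ.hasTemperateGrowth) hp

theorem integrable_const_mul_one_add_norm_pow (C : ℝ) (k : ℕ) :
    Integrable (fun w : W => C * (1 + ‖w‖) ^ k) μ := by
  rw [← memLp_one_iff_integrable]
  refine memLp_of_polyBounded (by fun_prop) ⟨‖C‖₊, k, fun w => le_of_eq ?_⟩ (by simp)
  dsimp only
  rw [enorm_mul, enorm_pow, ← ofReal_norm (1 + ‖w‖), Real.norm_of_nonneg (by positivity),
    ENNReal.ofReal_add (by simp) (by simp), ENNReal.ofReal_one, ofReal_norm]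
  rfl

end Moments

/-! ### Gaussian integration by parts. -/

section IntegrationByParts

variable {H W : Type*} [NormedAddCommGroup H] [InnerProductSpace ℝ H]
  [NormedAddCommGroup W] [NormedSpace ℝ W] [MeasurableSpace W] [BorelSpace W]
  {i : H →L[ℝ] W} {μ : Measure W}

theorem IsWienerSpace.map_eq_gaussianReal (h : IsWienerSpace i μ) (ℓ : StrongDual ℝ W) :
    μ.map ℓ = gaussianReal 0 (‖ℓ ∘L i‖₊ ^ 2) := by
  have := h.isProbabilityMeasure
  refine Measure.ext_of_charFun ?_
  ext u
  rw [charFun_map_eq_charFunDual_smul ℓ u, h.charFunDual_eq, charFun_gaussianReal,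
    ContinuousLinearMap.smul_comp, norm_smul]
  congr 1
  simp only [Real.norm_eq_abs, Complex.ofReal_mul, mul_pow, NNReal.coe_pow, coe_nnnorm,
    Complex.ofReal_pow, Complex.ofReal_zero, mul_zero, zero_mul, zero_sub]
  rw [← Complex.ofReal_pow |u|, sq_abs]
  push_cast
  ring

theorem IsWienerSpace.isGaussian (h : IsWienerSpace i μ) : IsGaussian μ :=
  isGaussian_of_map_eq_gaussianReal fun ℓ => ⟨_, _, h.map_eq_gaussianReal ℓ⟩

theorem IsWienerSpace.integral_dual (h : IsWienerSpace i μ) (ℓ : StrongDual ℝ W) :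
    ∫ w, ℓ w ∂μ = 0 := by
  have h1 : ∫ x, x ∂(μ.map ℓ) = 0 := by rw [h.map_eq_gaussianReal]; simp
  rwa [integral_map ℓ.continuous.aemeasurable (by fun_prop)] at h1

theorem IsWienerSpace.integral_dual_sq (h : IsWienerSpace i μ) (ℓ : StrongDual ℝ W) :
    ∫ w, ℓ w * ℓ w ∂μ = ‖ℓ ∘L i‖ ^ 2 := by
  have h1 : Var[fun x => x; μ.map ℓ] = ‖ℓ ∘L i‖ ^ 2 := by
    rw [h.map_eq_gaussianReal, variance_fun_id_gaussianReal]; simp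
  rw [variance_of_integral_eq_zero (by fun_prop) (by rw [h.map_eq_gaussianReal]; simp),
    integral_map ℓ.continuous.aemeasurable (by fun_prop)] at h1
  simpa [sq] using h1

theorem integrable_dual_mul_dual [IsGaussian μ] (ℓ m : StrongDual ℝ W) :
    Integrable (fun w => ℓ w * m w) μ :=
  (IsGaussian.memLp_dual μ ℓ 2 (by simp)).integrable_mul (IsGaussian.memLp_dual μ m 2 (by simp))

variable [CompleteSpace H]

/-- Polarization of the variance formula: the covariance of two functionals is the inner product of
their Riesz vectors. -/
theorem IsWienerSpace.integral_dual_mul_dual (h : IsWienerSpace i μ) (ℓ m : StrongDual ℝ W) :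
    ∫ w, ℓ w * m w ∂μ = ℓ (i (riesz i m)) := by
  have := h.isGaussian
  have hint := integrable_dual_mul_dual (μ := μ)
  have h1 := h.integral_dual_sq (ℓ + m)
  have h2 : ∫ w, (ℓ + m) w * (ℓ + m) w ∂μ =
      ∫ w, ℓ w * ℓ w ∂μ + 2 * ∫ w, ℓ w * m w ∂μ + ∫ w, m w * m w ∂μ := by
    have e : ∀ w, (ℓ + m) w * (ℓ + m) w = ℓ w * ℓ w + 2 * (ℓ w * m w) + m w * m w := fun w => by
      simp
      ring
    simp_rw [e]
    rw [integral_add (f := fun w => ℓ w * ℓ w + 2 * (ℓ w * m w))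
      ((hint _ _).add ((hint _ _).const_mul _)) (hint _ _),
      integral_add (hint _ _) ((hint _ _).const_mul _), integral_const_mul]
  rw [h2, h.integral_dual_sq, h.integral_dual_sq, ← norm_riesz, ← norm_riesz, ← norm_riesz,
    map_add, norm_add_sq_real, inner_riesz] at h1
  linarith

variable [CompleteSpace W] [SecondCountableTopology W]

/-- For independent copies w, w', the rotated pair (X_θ, Y_θ) has the same law for every θ, so
E[Φ(X_θ) ℓ(Y_θ)] is constant. Its derivative at θ = 0 is E[DΦ(w)(w') ℓ(w')] − E[Φ(w) ℓ(w)], and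
integrating over w' replaces the first integrand by the derivative along the Riesz vector of ℓ. -/
theorem IsWienerSpace.integral_fderiv_riesz (h : IsWienerSpace i μ) {Φ : W → ℝ}
    (hΦ : IsSmoothCylindrical Φ) (ℓ : StrongDual ℝ W) :
    ∫ w, fderiv ℝ Φ w (i (riesz i ℓ)) ∂μ = ∫ w, Φ w * ℓ w ∂μ := by
  have := h.isGaussian
  obtain ⟨k, C, hC, hb⟩ := hΦ.hasTemperateGrowth.norm_iteratedFDeriv_le_uniform 1
  have hb0 : ∀ x, ‖Φ x‖ ≤ C * (1 + ‖x‖) ^ k := fun x => by simpa using hb 0 (by simp) x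
  have hb1 : ∀ x, ‖fderiv ℝ Φ x‖ ≤ C * (1 + ‖x‖) ^ k := fun x => by
    simpa [norm_iteratedFDeriv_one] using hb 1 le_rfl x
  let X : ℝ → W × W → W := fun θ x => Real.cos θ • x.1 + Real.sin θ • x.2
  let Y : ℝ → W × W → W := fun θ x => -Real.sin θ • x.1 + Real.cos θ • x.2
  have hX : ∀ θ x, HasDerivAt (fun θ => X θ x) (Y θ x) θ := fun θ x =>
    ((Real.hasDerivAt_cos θ).smul_const x.1).add ((Real.hasDerivAt_sin θ).smul_const x.2)
  have hY : ∀ θ x, HasDerivAt (fun θ => Y θ x) (-X θ x) θ := fun θ x => by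
    have := ((Real.hasDerivAt_sin θ).neg.smul_const x.1).add
      ((Real.hasDerivAt_cos θ).smul_const x.2)
    rwa [neg_smul, neg_smul, ← neg_add] at this
  have hcomb : ∀ (a b : ℝ) (x : W × W), |a| ≤ 1 → |b| ≤ 1 → ‖a • x.1 + b • x.2‖ ≤ 2 * ‖x‖ :=
    fun a b x ha hb => by
      have h1 : ‖a • x.1‖ ≤ 1 * ‖x‖ := by
        rw [norm_smul]
        exact mul_le_mul ha (norm_fst_le x) (norm_nonneg _) zero_le_one
      have h2 : ‖b • x.2‖ ≤ 1 * ‖x‖ := by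
        rw [norm_smul]
        exact mul_le_mul hb (norm_snd_le x) (norm_nonneg _) zero_le_one
      linarith [norm_add_le (a • x.1) (b • x.2)]
  have hXn : ∀ θ x, ‖X θ x‖ ≤ 2 * (1 + ‖x‖) := fun θ x => by
    linarith [hcomb _ _ x (Real.abs_cos_le_one θ) (Real.abs_sin_le_one θ)]
  have hYn : ∀ θ x, ‖Y θ x‖ ≤ 2 * (1 + ‖x‖) := fun θ x => by
    linarith [hcomb _ _ x ((abs_neg _).trans_le (Real.abs_sin_le_one θ)) (Real.abs_cos_le_one θ)]
  have hXp : ∀ θ x, C * (1 + ‖X θ x‖) ^ k ≤ C * (2 * (1 + ‖x‖)) ^ k := fun θ x => by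
    gcongr
    linarith [hcomb _ _ x (Real.abs_cos_le_one θ) (Real.abs_sin_le_one θ)]
  have hXc : ∀ θ, Continuous (X θ) := fun θ => by fun_prop
  have hYc : ∀ θ, Continuous (Y θ) := fun θ => by fun_prop
  have hΦc := hΦ.continuous
  have hDc := hΦ.fderiv_right.continuous
  let F : ℝ → W × W → ℝ := fun θ x => Φ (X θ x) * ℓ (Y θ x)
  let F' : ℝ → W × W → ℝ := fun θ x =>
    fderiv ℝ Φ (X θ x) (Y θ x) * ℓ (Y θ x) + Φ (X θ x) * ℓ (-X θ x)
  -- The leading 2 counts the two terms of `F'`; the factors `2 ^ k` and 4 come from bounding X and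
  -- Y by `2 * (1 + ‖x‖)`, uniformly in θ.
  let bound : W × W → ℝ := fun x => (2 * C * 2 ^ k * 4 * ‖ℓ‖) * (1 + ‖x‖) ^ (k + 2)
  have hF' : ∀ θ x, ‖F' θ x‖ ≤ bound x := fun θ x => by
    have e1 : ‖fderiv ℝ Φ (X θ x) (Y θ x) * ℓ (Y θ x)‖ ≤
        (C * (2 * (1 + ‖x‖)) ^ k * (2 * (1 + ‖x‖))) * (‖ℓ‖ * (2 * (1 + ‖x‖))) := by
      rw [norm_mul]
      gcongr
      · exact (ContinuousLinearMap.le_opNorm _ _).trans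
          (mul_le_mul ((hb1 _).trans (hXp θ x)) (hYn θ x) (norm_nonneg _) (by positivity))
      · exact (ℓ.le_opNorm _).trans (by gcongr; exact hYn θ x)
    have e2 : ‖Φ (X θ x) * ℓ (-X θ x)‖ ≤
        (C * (2 * (1 + ‖x‖)) ^ k) * (‖ℓ‖ * (2 * (1 + ‖x‖))) := by
      rw [norm_mul]
      gcongr
      · exact (hb0 _).trans (hXp θ x)
      · exact (ℓ.le_opNorm _).trans (by rw [norm_neg]; gcongr; exact hXn θ x)
    have e3 : (C * (2 * (1 + ‖x‖)) ^ k) * (‖ℓ‖ * (2 * (1 + ‖x‖))) ≤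
        (C * (2 * (1 + ‖x‖)) ^ k * (2 * (1 + ‖x‖))) * (‖ℓ‖ * (2 * (1 + ‖x‖))) := by
      exact mul_le_mul_of_nonneg_right
        (le_mul_of_one_le_right (by positivity) (by linarith [norm_nonneg x])) (by positivity)
    calc ‖F' θ x‖ ≤ _ := norm_add_le _ _
      _ ≤ _ := add_le_add e1 (e2.trans e3)
      _ = bound x := by simp only [bound, mul_pow, pow_add]; ring
  have hbound : Integrable bound (μ.prod μ) := integrable_const_mul_one_add_norm_pow _ _
  have hFint : Integrable (F 0) (μ.prod μ) := by
    have : F 0 = fun x : W × W => Φ x.1 * ℓ x.2 := by ext x; simp [F, X, Y]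
    rw [this]
    exact ((hΦ.memLp (p := 1) (by simp)).integrable le_rfl).mul_prod
      (IsGaussian.integrable_dual μ ℓ)
  have hderiv := hasDerivAt_integral_of_dominated_loc_of_deriv_le (μ := μ.prod μ) (F := F)
    (F' := F') (x₀ := 0) (s := Set.univ) (bound := bound) univ_mem
    (Eventually.of_forall fun θ => by
      have : Continuous (F θ) := (hΦc.comp (hXc θ)).mul (ℓ.continuous.comp (hYc θ))
      exact this.aestronglyMeasurable) hFint
    (by
      have : Continuous (F' 0) := (((hDc.comp (hXc 0)).clm_apply (hYc 0)).mul
        (ℓ.continuous.comp (hYc 0))).add ((hΦc.comp (hXc 0)).mul (ℓ.continuous.comp (hXc 0).neg))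
      exact this.aestronglyMeasurable)
    (Eventually.of_forall fun x θ _ => hF' θ x) hbound
    (Eventually.of_forall fun x θ _ => by
      have d1 := (hΦ.differentiable (X θ x)).hasFDerivAt.comp_hasDerivAt θ (hX θ x)
      have d2 := (ℓ.hasFDerivAt (x := Y θ x)).comp_hasDerivAt θ (hY θ x)
      exact d1.mul d2)
  have hconst : ∀ θ, ∫ x, F θ x ∂(μ.prod μ) = ∫ x, Φ x.1 * ℓ x.2 ∂(μ.prod μ) := fun θ => by
    conv_rhs => rw [← IsGaussian.map_rotation_eq_self_of_forall_strongDual_eq_zero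
      (μ := μ) h.integral_dual θ]
    rw [integral_map (by fun_prop) (Continuous.aestronglyMeasurable (by fun_prop))]
    rfl
  have hzero : ∫ x, F' 0 x ∂(μ.prod μ) = 0 := by
    refine hderiv.2.unique ?_
    simp_rw [hconst]
    exact hasDerivAt_const _ _
  rw [integral_prod _ hderiv.1] at hzero
  -- With w fixed, DΦ(w) is a continuous functional of w', so the covariance formula evaluates the
  -- inner integral.
  have hF0 : ∀ w, ∫ w', F' 0 (w, w') ∂μ =
      fderiv ℝ Φ w (i (riesz i ℓ)) - Φ w * ℓ w := fun w => by
    have : ∀ w', F' 0 (w, w') = fderiv ℝ Φ w w' * ℓ w' - Φ w * ℓ w := fun w' => by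
      simp [F', X, Y, sub_eq_add_neg]
    simp_rw [this]
    rw [integral_sub (integrable_dual_mul_dual _ _) (integrable_const _),
      h.integral_dual_mul_dual]
    simp
  simp_rw [hF0] at hzero
  rwa [integral_sub (((hΦ.fderiv_apply _).memLp (p := 1) (by simp)).integrable le_rfl)
    (((hΦ.mul (.dual ℓ)).memLp (p := 1) (by simp)).integrable le_rfl), sub_eq_zero] at hzero

end IntegrationByParts

/-! ### L^p convergence of bilinear expressions. -/

section Convergence

variable {Ω E F G : Type*} [MeasurableSpace Ω] {μ : Measure Ω} [NormedAddCommGroup E]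
  [NormedSpace ℝ E] [NormedAddCommGroup F] [NormedSpace ℝ F] [NormedAddCommGroup G]
  [NormedSpace ℝ G]

theorem eLpNorm_bilin_le (B : E →L[ℝ] F →L[ℝ] G) {p q r : ℝ≥0∞} [ENNReal.HolderTriple p q r]
    {u : Ω → E} {v : Ω → F} (hu : AEStronglyMeasurable u μ) (hv : AEStronglyMeasurable v μ) :
    eLpNorm (fun w => B (u w) (v w)) r μ ≤ ‖B‖ₑ * eLpNorm u p μ * eLpNorm v q μ :=
  eLpNorm_le_eLpNorm_mul_eLpNorm'_of_norm hu hv (fun x y => B x y) ‖B‖₊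
    (Eventually.of_forall fun w => B.le_opNorm₂ (u w) (v w))

theorem tendsto_eLpNorm_bilin (B : E →L[ℝ] F →L[ℝ] G) {p q r : ℝ≥0∞}
    [ENNReal.HolderTriple p q r] (hr : 1 ≤ r) {u : ℕ → Ω → E} {v : ℕ → Ω → F} {u' : Ω → E}
    {v' : Ω → F} (hu : ∀ n, AEStronglyMeasurable (u n) μ) (hv : ∀ n, AEStronglyMeasurable (v n) μ)
    (hu' : MemLp u' p μ) (hv' : MemLp v' q μ)
    (hut : Tendsto (fun n => eLpNorm (fun w => u n w - u' w) p μ) atTop (𝓝 0))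
    (hvt : Tendsto (fun n => eLpNorm (fun w => v n w - v' w) q μ) atTop (𝓝 0)) :
    Tendsto (fun n => eLpNorm (fun w => B (u n w) (v n w) - B (u' w) (v' w)) r μ) atTop
      (𝓝 0) := by
  have hlim : Tendsto (fun n => ‖B‖ₑ * eLpNorm (fun w => u n w - u' w) p μ *
        eLpNorm (fun w => v n w - v' w) q μ + ‖B‖ₑ * eLpNorm (fun w => u n w - u' w) p μ *
        eLpNorm v' q μ + ‖B‖ₑ * eLpNorm u' p μ * eLpNorm (fun w => v n w - v' w) q μ)
      atTop (𝓝 0) := by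
    have hB : Tendsto (fun n => ‖B‖ₑ * eLpNorm (fun w => u n w - u' w) p μ) atTop (𝓝 0) := by
      simpa using ENNReal.Tendsto.const_mul hut (.inr (by simp))
    have h1 := ENNReal.Tendsto.mul hB (.inr (by simp)) hvt (.inr (by simp))
    have h2 := ENNReal.Tendsto.mul_const (b := eLpNorm v' q μ) hB (.inr hv'.2.ne)
    have h3 := ENNReal.Tendsto.const_mul (a := ‖B‖ₑ * eLpNorm u' p μ) hvt
      (.inr (ENNReal.mul_ne_top (by simp) hu'.2.ne))
    simpa using (h1.add h2).add h3
  refine tendsto_of_tendsto_of_tendsto_of_le_of_le tendsto_const_nhds hlim (fun _ => zero_le)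
    fun n => ?_
  have hun := (hu n).sub hu'.1
  have hvn := (hv n).sub hv'.1
  -- Expanding around the limits means that only the norms of u' and v' need be finite; no uniform
  -- bound on the sequences is required.
  have e : (fun w => B (u n w) (v n w) - B (u' w) (v' w)) =
      ((fun w => B (u n w - u' w) (v n w - v' w)) + fun w => B (u n w - u' w) (v' w)) +
        fun w => B (u' w) (v n w - v' w) := by
    ext w
    simp only [map_sub, sub_apply, Pi.add_apply]
    abel
  have hm : ∀ {f : Ω → E} {g : Ω → F}, AEStronglyMeasurable f μ → AEStronglyMeasurable g μ →
      AEStronglyMeasurable (fun w => B (f w) (g w)) μ := fun hf hg =>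
    B.aestronglyMeasurable_comp₂ hf hg
  rw [e]
  refine (eLpNorm_add_le ((hm hun hvn).add (hm hun hv'.1)) (hm hu'.1 hvn) hr).trans ?_
  refine add_le_add ((eLpNorm_add_le (hm hun hvn) (hm hun hv'.1) hr).trans (add_le_add ?_ ?_)) ?_
  · exact eLpNorm_bilin_le B hun hvn
  · exact eLpNorm_bilin_le B hun hv'.1
  · exact eLpNorm_bilin_le B hu'.1 hvn

omit [NormedSpace ℝ E] in
theorem memLp_of_tendsto_eLpNorm {p : ℝ≥0∞} {u : ℕ → Ω → E} {u' : Ω → E}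
    (hu : ∀ n, MemLp (u n) p μ) (hu' : AEStronglyMeasurable u' μ)
    (h : Tendsto (fun n => eLpNorm (fun w => u n w - u' w) p μ) atTop (𝓝 0)) : MemLp u' p μ := by
  obtain ⟨n, hn⟩ := (h.eventually (gt_mem_nhds ENNReal.zero_lt_top)).exists
  have := (hu n).sub (⟨(hu n).1.sub hu', hn⟩ : MemLp (fun w => u n w - u' w) p μ)
  refine this.congr_norm hu' (Eventually.of_forall fun w => ?_)
  simp

omit [NormedSpace ℝ E] in
theorem ae_eq_of_tendsto_eLpNorm {p : ℝ≥0∞} (hp : 1 ≤ p) {u : ℕ → Ω → E} {u' u'' : Ω → E}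
    (hu : ∀ n, AEStronglyMeasurable (u n) μ) (hu' : AEStronglyMeasurable u' μ)
    (hu'' : AEStronglyMeasurable u'' μ)
    (h' : Tendsto (fun n => eLpNorm (fun w => u n w - u' w) p μ) atTop (𝓝 0))
    (h'' : Tendsto (fun n => eLpNorm (fun w => u n w - u'' w) p μ) atTop (𝓝 0)) :
    u' =ᵐ[μ] u'' := by
  have h0 : eLpNorm (fun w => u' w - u'' w) p μ = 0 := by
    refine le_antisymm (ge_of_tendsto' (x := atTop) (by simpa using h''.add h') fun n => ?_) zero_le
    have e : (fun w => u' w - u'' w) = (fun w => u n w - u'' w) - fun w => u n w - u' w := by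
      ext w
      simp
    rw [e]
    exact eLpNorm_sub_le ((hu n).sub hu'') ((hu n).sub hu') hp
  filter_upwards [(eLpNorm_eq_zero_iff (hu'.sub hu'') (by positivity)).1 h0] with w hw
  exact sub_eq_zero.1 hw

end Convergence

/-! ### Sine and cosine as admissible test functions. -/

theorem hasTemperateGrowth_of_abs_iteratedDeriv_le {f : ℝ → ℝ} (hf : ContDiff ℝ (⊤ : ℕ∞) f)
    (h : ∀ n x, |iteratedDeriv n f x| ≤ 1) : f.HasTemperateGrowth :=
  ⟨hf, fun n => ⟨0, 1, fun x => by
    simpa [norm_iteratedFDeriv_eq_norm_iteratedDeriv] using h n x⟩⟩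

theorem abs_iteratedDeriv_sin_cos_le (n : ℕ) :
    (∀ x, |iteratedDeriv n Real.sin x| ≤ 1) ∧ ∀ x, |iteratedDeriv n Real.cos x| ≤ 1 := by
  induction n with
  | zero => simpa using ⟨Real.abs_sin_le_one, Real.abs_cos_le_one⟩
  | succ n ih =>
    rw [Real.iteratedDeriv_add_one_sin, Real.iteratedDeriv_add_one_cos]
    simpa using ⟨ih.2, ih.1⟩

theorem hasTemperateGrowth_sin : Real.sin.HasTemperateGrowth :=
  hasTemperateGrowth_of_abs_iteratedDeriv_le Real.contDiff_sin fun n =>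
    (abs_iteratedDeriv_sin_cos_le n).1

theorem hasTemperateGrowth_cos : Real.cos.HasTemperateGrowth :=
  hasTemperateGrowth_of_abs_iteratedDeriv_le Real.contDiff_cos fun n =>
    (abs_iteratedDeriv_sin_cos_le n).2

/-! ### Closability of the gradient. -/

section Closability

theorem IsSmoothCylindrical.integrable {W E : Type*} [NormedAddCommGroup W] [NormedSpace ℝ W]
    [CompleteSpace W] [SecondCountableTopology W] [MeasurableSpace W] [BorelSpace W]
    [NormedAddCommGroup E] [NormedSpace ℝ E] {μ : Measure W} [IsGaussian μ] {Φ : W → E}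
    (hΦ : IsSmoothCylindrical Φ) : Integrable Φ μ :=
  memLp_one_iff_integrable.1 (hΦ.memLp (by simp))

variable {H W : Type*} [NormedAddCommGroup H] [InnerProductSpace ℝ H] [CompleteSpace H]
  [NormedAddCommGroup W] [NormedSpace ℝ W] [CompleteSpace W] [SecondCountableTopology W]
  [MeasurableSpace W] [BorelSpace W] {i : H →L[ℝ] W} {μ : Measure W}

omit [CompleteSpace H] in
-- The finite measures X⁺μ and X⁻μ have the same characteristic functional, hence coincide. Their
-- densities then agree almost everywhere, which forces X = 0.
theorem ae_eq_zero_of_forall_integral_exp_eq_zero [IsFiniteMeasure μ] {X : W → ℝ}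
    (hX : Integrable X μ)
    (h : ∀ ℓ : StrongDual ℝ W, ∫ w, (X w : ℂ) * Complex.exp (ℓ w * Complex.I) ∂μ = 0) :
    X =ᵐ[μ] 0 := by
  let μ₁ := μ.withDensity fun w => ENNReal.ofReal (X w)
  let μ₂ := μ.withDensity fun w => ENNReal.ofReal (-X w)
  have f₁ : IsFiniteMeasure μ₁ := isFiniteMeasure_withDensity_ofReal hX.2
  have f₂ : IsFiniteMeasure μ₂ := isFiniteMeasure_withDensity_ofReal hX.neg.2
  have m₁ : AEMeasurable (fun w => ENNReal.ofReal (X w)) μ := hX.1.aemeasurable.ennreal_ofReal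
  have m₂ : AEMeasurable (fun w => ENNReal.ofReal (-X w)) μ := hX.neg.1.aemeasurable.ennreal_ofReal
  have heq : μ₁ = μ₂ := by
    refine Measure.ext_of_charFunDual ?_
    ext ℓ
    rw [charFunDual_apply, charFunDual_apply, ← sub_eq_zero, ← h ℓ,
      integral_withDensity_eq_integral_toReal_smul₀ m₁ (by simp),
      integral_withDensity_eq_integral_toReal_smul₀ m₂ (by simp), ← integral_sub]
    · congr 1
      ext w
      rw [← sub_smul, Complex.real_smul]
      congr 2
      rcases le_total 0 (X w) with h0 | h0 <;> simp [ENNReal.toReal_ofReal', h0]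
    all_goals
      refine Integrable.mono' hX.norm ((AEMeasurable.ennreal_toReal ‹_›).aestronglyMeasurable.smul
        (Continuous.aestronglyMeasurable (by fun_prop))) (Eventually.of_forall fun w => ?_)
      rw [norm_smul, Complex.norm_exp_ofReal_mul_I, mul_one, Real.norm_eq_abs, Real.norm_eq_abs,
        abs_of_nonneg ENNReal.toReal_nonneg, ENNReal.toReal_ofReal']
      exact max_le (by first | exact le_abs_self _ | exact neg_le_abs _) (abs_nonneg _)
  have hfin : ∫⁻ w, ENNReal.ofReal (X w) ∂μ ≠ ∞ := by
    simpa [μ₁] using measure_ne_top μ₁ Set.univ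
  filter_upwards [(withDensity_eq_iff m₁ m₂ hfin).1 heq] with w hw
  have hw' := congrArg ENNReal.toReal hw
  rw [ENNReal.toReal_ofReal', ENNReal.toReal_ofReal'] at hw'
  rcases le_total 0 (X w) with h0 | h0 <;> simpa [h0, eq_comm] using hw'

omit [CompleteSpace W] [SecondCountableTopology W] [MeasurableSpace W] [BorelSpace W] in
-- If x is orthogonal to every Riesz vector, all functionals vanish at `i x`. Continuous functionals
-- separate points of W, so `i x = 0` and x = 0 by injectivity.
theorem dense_range_riesz (hi : Function.Injective i) : DenseRange (riesz i) := by
  have h : (LinearMap.range (riesz i).toLinearMap).topologicalClosure = ⊤ := by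
    rw [Submodule.topologicalClosure_eq_top_iff, eq_bot_iff]
    intro x hx
    rw [Submodule.mem_orthogonal] at hx
    have h1 : i x = 0 := by
      refine SeparatingDual.eq_zero_of_forall_dual_eq_zero (R := ℝ) fun ℓ => ?_
      rw [← inner_riesz]
      exact hx _ ⟨ℓ, rfl⟩
    exact hi (by simpa using h1)
  rw [← Submodule.dense_iff_topologicalClosure_eq_top] at h
  exact h

/-- The gradient is closable: a null sequence whose gradients converge has gradients converging
to zero. -/
theorem IsWienerSpace.ae_eq_zero_of_tendsto_cylGrad [SecondCountableTopology H]
    (h : IsWienerSpace i μ) {Φ : ℕ → W → ℝ} (hΦ : ∀ n, IsSmoothCylindrical (Φ n)) {u : W → H}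
    (hu : AEStronglyMeasurable u μ) (h0 : Tendsto (fun n => eLpNorm (Φ n) 2 μ) atTop (𝓝 0))
    (h1 : Tendsto (fun n => eLpNorm (fun w => cylGrad i (Φ n) w - u w) 2 μ) atTop (𝓝 0)) :
    u =ᵐ[μ] 0 := by
  have := h.isGaussian
  have hu2 : MemLp u 2 μ :=
    memLp_of_tendsto_eLpNorm (fun n => ((hΦ n).cylGrad i).memLp (by simp)) hu h1
  -- Integration by parts for Φ_n G gives ∫ ⟨∇Φ_n, h⟩ G = ∫ Φ_n K, where h is the Riesz vector of ℓ
  -- and K = G ℓ − D_h G. The right side tends to 0 with Φ_n, the left side to ∫ ⟨u, h⟩ G.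
  have key : ∀ (ℓ : StrongDual ℝ W) {G : W → ℝ}, IsSmoothCylindrical G →
      ∫ w, inner ℝ (u w) (riesz i ℓ) * G w ∂μ = 0 := fun ℓ G hG => by
    have hG2 : MemLp (fun w => G w • riesz i ℓ) 2 μ :=
      (hG.clm ((ContinuousLinearMap.id ℝ ℝ).smulRight (riesz i ℓ))).memLp (by simp)
    let K : W → ℝ := fun w => G w * ℓ w - fderiv ℝ G w (i (riesz i ℓ))
    have hK : IsSmoothCylindrical K := (hG.mul (.dual ℓ)).sub (hG.fderiv_apply _)
    have t1 := tendsto_eLpNorm_bilin (innerSL ℝ) (p := 2) (q := 2) (r := 1) le_rfl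
      (fun n => (((hΦ n).cylGrad i).memLp (p := 2) (μ := μ) (by simp)).1) (fun _ => hG2.1) hu2 hG2
      h1 (by simp)
    have t2 := tendsto_eLpNorm_bilin (ContinuousLinearMap.mul ℝ ℝ) (p := 2) (q := 2) (r := 1)
      (u' := 0) le_rfl (fun n => ((hΦ n).memLp (p := 2) (μ := μ) (by simp)).1)
      (fun _ => (hK.memLp (p := 2) (by simp)).1) MemLp.zero (hK.memLp (μ := μ) (by simp))
      (by simpa using h0) (by simp)
    have hI₁ : ∀ n, Integrable (fun w => innerSL ℝ (cylGrad i (Φ n) w) (G w • riesz i ℓ)) μ :=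
      fun n => (IsSmoothCylindrical.bilin (innerSL ℝ) ((hΦ n).cylGrad i)
        (hG.clm ((ContinuousLinearMap.id ℝ ℝ).smulRight (riesz i ℓ)))).integrable
    have hI₂ : ∀ n, Integrable (fun w => ContinuousLinearMap.mul ℝ ℝ (Φ n w) (K w)) μ :=
      fun n => ((hΦ n).mul hK).integrable
    have e : ∀ n, ∫ w, innerSL ℝ (cylGrad i (Φ n) w) (G w • riesz i ℓ) ∂μ =
        ∫ w, ContinuousLinearMap.mul ℝ ℝ (Φ n w) (K w) ∂μ := fun n => by
      have ibp := h.integral_fderiv_riesz ((hΦ n).mul hG) ℓ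
      have e1 : ∀ w, fderiv ℝ (fun w => Φ n w * G w) w (i (riesz i ℓ)) =
          Φ n w * fderiv ℝ G w (i (riesz i ℓ)) +
            innerSL ℝ (cylGrad i (Φ n) w) (G w • riesz i ℓ) := fun w => by
        rw [fderiv_fun_mul ((hΦ n).differentiable w) (hG.differentiable w)]
        simp [inner_cylGrad]
      have e2 : ∀ w, Φ n w * G w * ℓ w = Φ n w * fderiv ℝ G w (i (riesz i ℓ)) +
          ContinuousLinearMap.mul ℝ ℝ (Φ n w) (K w) := fun w => by
        simp [K]
        ring
      simp_rw [e1, e2] at ibp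
      rw [integral_add ((hΦ n).mul (hG.fderiv_apply _)).integrable (hI₁ n),
        integral_add ((hΦ n).mul (hG.fderiv_apply _)).integrable (hI₂ n)] at ibp
      exact add_left_cancel ibp
    have l1 := tendsto_integral_of_L1' (fun w => innerSL ℝ (u w) (G w • riesz i ℓ))
      ((innerSL ℝ).aestronglyMeasurable_comp₂ hu hG2.1) (Eventually.of_forall hI₁) t1
    have l2 := tendsto_integral_of_L1' (fun w => ContinuousLinearMap.mul ℝ ℝ 0 (K w))
      (by simpa using aestronglyMeasurable_const)
      (Eventually.of_forall hI₂) t2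
    simp_rw [e] at l1
    have := tendsto_nhds_unique l1 l2
    simpa [real_inner_smul_right, mul_comm, -coe_innerSL_apply, innerSL_apply_apply] using this
  have hℓ : ∀ ℓ : StrongDual ℝ W, (fun w => inner ℝ (riesz i ℓ) (u w)) =ᵐ[μ] 0 := fun ℓ => by
    have hint : Integrable (fun w => inner ℝ (riesz i ℓ) (u w)) μ :=
      (hu2.integrable (by simp)).const_inner _
    have hcyl : ∀ {G : W → ℝ}, IsSmoothCylindrical G →
        Integrable (fun w => inner ℝ (u w) (riesz i ℓ) * G w) μ := fun hG =>
      (hu2.inner_const _).integrable_mul (hG.memLp (p := 2) (by simp))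
    refine ae_eq_zero_of_forall_integral_exp_eq_zero hint fun m => ?_
    -- The real and imaginary parts are integrals against the cylindrical functionals cos(m w) and
    -- sin(m w), to which `key` applies.
    have e : ∀ w, ((inner ℝ (riesz i ℓ) (u w) : ℝ) : ℂ) * Complex.exp (m w * Complex.I) =
        ((inner ℝ (u w) (riesz i ℓ) * Real.cos (m w) : ℝ) : ℂ) +
          ((inner ℝ (u w) (riesz i ℓ) * Real.sin (m w) : ℝ) : ℂ) * Complex.I := fun w => by
      rw [Complex.exp_mul_I, real_inner_comm]
      push_cast
      ring
    simp_rw [e]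
    rw [integral_add, integral_mul_const, integral_complex_ofReal, integral_complex_ofReal,
      key ℓ ((IsSmoothCylindrical.dual m).comp_temperate hasTemperateGrowth_cos),
      key ℓ ((IsSmoothCylindrical.dual m).comp_temperate hasTemperateGrowth_sin)]
    · simp
    · exact (hcyl ((IsSmoothCylindrical.dual m).comp_temperate hasTemperateGrowth_cos)).ofReal
    · exact (hcyl ((IsSmoothCylindrical.dual m).comp_temperate
        hasTemperateGrowth_sin)).ofReal.mul_const _
  refine ae_eq_zero_of_forall_inner (𝕜 := ℝ) fun c => ?_
  -- A single sequence of Riesz vectors tending to c keeps the union of the exceptional null sets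
  -- countable.
  obtain ⟨x, hx, hxc⟩ := mem_closure_iff_seq_limit.1 ((dense_range_riesz h.injective) c)
  choose ℓ hℓx using hx
  have : ∀ᵐ w ∂μ, ∀ n, inner ℝ (x n) (u w) = 0 := by
    rw [ae_all_iff]
    intro n
    filter_upwards [hℓ (ℓ n)] with w hw
    rw [← hℓx]
    exact hw
  filter_upwards [this] with w hw
  refine tendsto_nhds_unique (hxc.inner tendsto_const_nhds) ?_
  simp [hw]

end Closability

/-! ### Inequalities for powers and their integrals. -/

section Powers

/-- Bounding a sum by twice its maximum works for every q ≥ 0. Convexity would not do, since q = p/2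
can be below 1. -/
theorem add_rpow_le (x y : ℝ≥0∞) {q : ℝ} (hq : 0 ≤ q) :
    (x + y) ^ q ≤ 2 ^ q * (x ^ q + y ^ q) := by
  wlog h : x ≤ y generalizing x y
  · rw [add_comm x, add_comm (x ^ q)]
    exact this y x (le_of_not_ge h)
  calc (x + y) ^ q ≤ (2 * y) ^ q := by
        refine ENNReal.rpow_le_rpow ?_ hq
        rw [two_mul]
        gcongr
    _ = 2 ^ q * y ^ q := ENNReal.mul_rpow_of_nonneg _ _ hq
    _ ≤ _ := by gcongr; exact le_add_self

theorem sum_rpow_le {κ : Type*} (s : Finset κ) (a : κ → ℝ≥0∞) {q : ℝ} (hq : 0 < q) :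
    (∑ j ∈ s, a j) ^ q ≤ (s.card : ℝ≥0∞) ^ q * ∑ j ∈ s, a j ^ q := by
  rcases s.eq_empty_or_nonempty with rfl | hs
  · simp [hq]
  obtain ⟨k, hk, hmax⟩ := s.exists_max_image a hs
  calc (∑ j ∈ s, a j) ^ q ≤ (s.card * a k) ^ q := by
        refine ENNReal.rpow_le_rpow ?_ hq.le
        simpa using Finset.sum_le_card_nsmul s a (a k) hmax
    _ = (s.card : ℝ≥0∞) ^ q * a k ^ q := ENNReal.mul_rpow_of_nonneg _ _ hq.le
    _ ≤ _ := by
        gcongr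
        exact Finset.single_le_sum (f := fun j => a j ^ q) (fun _ _ => zero_le) hk

theorem lintegral_mul_rpow_le {Ω : Type*} [MeasurableSpace Ω] {μ : Measure Ω} {X Y : Ω → ℝ≥0∞}
    (hX : Measurable X) (hY : Measurable Y) {q : ℝ} (hq : 0 ≤ q) :
    ∫⁻ w, (X w * Y w) ^ q ∂μ ≤
      (∫⁻ w, X w ^ (2 * q) ∂μ) ^ (1 / 2 : ℝ) * (∫⁻ w, Y w ^ (2 * q) ∂μ) ^ (1 / 2 : ℝ) := by
  have h := ENNReal.lintegral_mul_le_Lp_mul_Lq μ Real.HolderConjugate.two_two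
    (hX.pow_const q).aemeasurable (hY.pow_const q).aemeasurable
  simpa only [Pi.mul_apply, ← ENNReal.mul_rpow_of_nonneg _ _ hq, ← ENNReal.rpow_mul,
    mul_comm q 2] using h

theorem lintegral_rpow_le_sqrt {Ω : Type*} [MeasurableSpace Ω] {μ : Measure Ω}
    [IsProbabilityMeasure μ] {X : Ω → ℝ≥0∞} (hX : Measurable X) {q : ℝ} (hq : 0 ≤ q) :
    ∫⁻ w, X w ^ q ∂μ ≤ (∫⁻ w, X w ^ (2 * q) ∂μ) ^ (1 / 2 : ℝ) := by
  simpa using lintegral_mul_rpow_le (μ := μ) hX (measurable_const (a := 1)) hq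

theorem tendsto_rpow_half {α : Type*} {l : Filter α} {f : α → ℝ≥0∞} (h : Tendsto f l (𝓝 0)) :
    Tendsto (fun x => f x ^ (1 / 2 : ℝ)) l (𝓝 0) := by
  have := (ENNReal.continuous_rpow_const (y := 1 / 2)).tendsto 0 |>.comp h
  simpa [Function.comp_def] using this

theorem lintegral_const_mul_const_mul_add {Ω : Type*} [MeasurableSpace Ω] {μ : Measure Ω}
    {X Y : Ω → ℝ≥0∞} (hX : Measurable X) (hY : Measurable Y) (c d : ℝ≥0∞) :
    ∫⁻ w, c * (d * (X w + Y w)) ∂μ = c * (d * ((∫⁻ w, X w ∂μ) + ∫⁻ w, Y w ∂μ)) := by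
  have h : Measurable fun w => X w + Y w := hX.add hY
  rw [lintegral_const_mul _ (h.const_mul _), lintegral_const_mul _ h, lintegral_add_left hX]

theorem holderTriple_two_mul (p : ℝ≥0) :
    ENNReal.HolderTriple ((2 * p : ℝ≥0) : ℝ≥0∞) ((2 * p : ℝ≥0) : ℝ≥0∞) (p : ℝ≥0∞) where
  inv_add_inv_eq_inv := by
    rw [ENNReal.coe_mul, ENNReal.coe_ofNat, ENNReal.mul_inv (by simp) (by simp), ← add_mul,
      ENNReal.inv_two_add_inv_two, one_mul]

end Powers

/-! ### Sobolev approximations and their stability under pairings. -/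

section Approximation

variable {H W ι : Type*} [NormedAddCommGroup H] [InnerProductSpace ℝ H]
  [NormedAddCommGroup W] [NormedSpace ℝ W] [MeasurableSpace W] [BorelSpace W]
  {i : H →L[ℝ] W} {b : HilbertBasis ι ℝ H} {μ : Measure W}

/-- The smooth cylindrical functionals `Φ n` converge to `F` in the Sobolev space of order `r` and
exponent `p`. -/
structure SobolevApprox (i : H →L[ℝ] W) (b : HilbertBasis ι ℝ H) (μ : Measure W) (r : ℕ) (p : ℝ≥0)
    (F : W → ℝ) (Φ : ℕ → W → ℝ) : Prop where
  cyl : ∀ n, IsSmoothCylindrical (Φ n)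
  aestronglyMeasurable : AEStronglyMeasurable F μ
  tendsto : Tendsto (fun n => eLpNorm (fun w => Φ n w - F w) p μ) atTop (𝓝 0)
  cauchy : Tendsto (fun mn : ℕ × ℕ =>
    ∫⁻ w, totalEnergy i b r (fun w => Φ mn.1 w - Φ mn.2 w) w ^ ((p : ℝ) / 2) ∂μ) atTop (𝓝 0)

/-- The separate conditions on the orders j ≤ r merge into one on the total energy; the exponent p
becomes p/2 because energies are squared norms. -/
theorem exists_sobolevApprox [CompleteSpace H] {F : W → ℝ} (hF : MemWInfty i μ F) (r : ℕ) {p : ℝ≥0}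
    (hp : 1 ≤ p) :
    ∃ Φ, SobolevApprox i (exists_hilbertBasis ℝ H).choose_spec.choose μ r p F Φ := by
  obtain ⟨Φ, hΦ, ht, hc⟩ := hF.2 r p hp
  set b := (exists_hilbertBasis ℝ H).choose_spec.choose
  have hp0 : (0 : ℝ) < p / 2 := by have : (0 : ℝ) < p := by exact_mod_cast one_pos.trans_le hp
                                   positivity
  refine ⟨Φ, hΦ, hF.1, ht, ?_⟩
  have hsub : ∀ m n, IsSmoothCylindrical fun w => Φ m w - Φ n w := fun m n => (hΦ m).sub (hΦ n)
  have hlim : Tendsto (fun mn : ℕ × ℕ => ((Finset.range (r + 1)).card : ℝ≥0∞) ^ ((p : ℝ) / 2) *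
      ∑ j ∈ Finset.range (r + 1), ∫⁻ w, energy i b j (fun w => Φ mn.1 w - Φ mn.2 w) w ^
        ((p : ℝ) / 2) ∂μ) atTop (𝓝 0) := by
    have : Tendsto (fun mn : ℕ × ℕ => ∑ j ∈ Finset.range (r + 1),
        ∫⁻ w, energy i b j (fun w => Φ mn.1 w - Φ mn.2 w) w ^ ((p : ℝ) / 2) ∂μ) atTop
        (𝓝 (∑ j ∈ Finset.range (r + 1), 0)) := by
      refine tendsto_finsetSum _ fun j hj => ?_
      refine (hc j (by simpa [Nat.lt_succ_iff] using hj)).congr fun mn => ?_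
      congr! 2 with w
      change hsNorm j (fun x => cylDeriv i j (fun w => Φ mn.1 w - Φ mn.2 w) w x) ^ (p : ℝ) = _
      rw [hsNorm_cylDeriv i j (hsub mn.1 mn.2), ← ENNReal.rpow_mul]
      congr 1
      ring
    simpa using ENNReal.Tendsto.const_mul this
      (.inr (ENNReal.rpow_ne_top_of_nonneg hp0.le (by simp)))
  refine tendsto_of_tendsto_of_tendsto_of_le_of_le tendsto_const_nhds hlim (fun _ => zero_le)
    fun mn => ?_
  dsimp only
  rw [← lintegral_finsetSum _ fun j _ => (measurable_energy i b j (hsub _ _)).pow_const _,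
    ← lintegral_const_mul _ (Finset.measurable_sum _ fun j _ =>
      (measurable_energy i b j (hsub _ _)).pow_const _)]
  exact lintegral_mono fun w => sum_rpow_le _ _ hp0

omit [BorelSpace W] in
theorem memWInfty_of_sobolevApprox [CompleteSpace H] {F : W → ℝ} (hF : AEStronglyMeasurable F μ)
    (h : ∀ (r : ℕ) (p : ℝ≥0), 1 ≤ p →
      ∃ Φ, SobolevApprox i (exists_hilbertBasis ℝ H).choose_spec.choose μ r p F Φ) :
    MemWInfty i μ F := by
  refine ⟨hF, fun r p hp => ?_⟩
  obtain ⟨Φ, hΦ⟩ := h r p hp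
  refine ⟨Φ, hΦ.cyl, hΦ.tendsto, fun j hj => ?_⟩
  refine tendsto_of_tendsto_of_tendsto_of_le_of_le tendsto_const_nhds hΦ.cauchy
    (fun _ => zero_le) fun mn => lintegral_mono fun w => ?_
  change hsNorm j (fun x => cylDeriv i j (fun w => Φ mn.1 w - Φ mn.2 w) w x) ^ (p : ℝ) ≤ _
  rw [hsNorm_cylDeriv i j ((hΦ.cyl _).sub (hΦ.cyl _)), ← ENNReal.rpow_mul, one_div_mul_eq_div]
  exact ENNReal.rpow_le_rpow (energy_le_totalEnergy i _ hj _ w) (by positivity)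

namespace SobolevApprox

variable {r s : ℕ} {p : ℝ≥0} {F G : W → ℝ} {Φ Ψ : ℕ → W → ℝ}

omit [BorelSpace W] in
theorem congr (hF : SobolevApprox i b μ r p F Φ) (h : F =ᵐ[μ] G) :
    SobolevApprox i b μ r p G Φ where
  cyl := hF.cyl
  aestronglyMeasurable := hF.aestronglyMeasurable.congr h
  tendsto := hF.tendsto.congr fun n => eLpNorm_congr_ae (by filter_upwards [h] with w hw; rw [hw])
  cauchy := hF.cauchy

omit [BorelSpace W] in
theorem const (c : ℝ) (hp : 1 ≤ p) :
    SobolevApprox i b μ r p (fun _ => c) fun _ _ => c where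
  cyl _ := .const c
  aestronglyMeasurable := aestronglyMeasurable_const
  tendsto := by simp
  cauchy := by
    have h0 : ∀ w, totalEnergy i b r (fun _ => (0 : ℝ)) w = 0 := fun w => by
      simpa using totalEnergy_const_smul i b 0 r (IsSmoothCylindrical.const (0 : ℝ)) w
    have : (0 : ℝ) < p := by exact_mod_cast one_pos.trans_le hp
    simp [h0, this]

theorem add (hF : SobolevApprox i b μ r p F Φ) (hG : SobolevApprox i b μ r p G Ψ) (hp : 1 ≤ p) :
    SobolevApprox i b μ r p (fun w => F w + G w) fun n w => Φ n w + Ψ n w where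
  cyl n := (hF.cyl n).add (hG.cyl n)
  aestronglyMeasurable := hF.aestronglyMeasurable.add hG.aestronglyMeasurable
  tendsto := by
    refine tendsto_of_tendsto_of_tendsto_of_le_of_le tendsto_const_nhds
      (by simpa using hF.tendsto.add hG.tendsto) (fun _ => zero_le) fun n => ?_
    have e : (fun w => Φ n w + Ψ n w - (F w + G w)) =
        (fun w => Φ n w - F w) + fun w => Ψ n w - G w := by
      ext w
      simp
      ring
    dsimp only
    rw [e]
    exact eLpNorm_add_le ((hF.cyl n).continuous.measurable.aestronglyMeasurable.sub
      hF.aestronglyMeasurable) ((hG.cyl n).continuous.measurable.aestronglyMeasurable.sub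
      hG.aestronglyMeasurable) (by exact_mod_cast hp)
  cauchy := by
    have hq : 0 ≤ (p : ℝ) / 2 := by positivity
    have hlim : Tendsto (fun mn : ℕ × ℕ => 2 ^ ((p : ℝ) / 2) * (2 ^ ((p : ℝ) / 2) *
        ((∫⁻ w, totalEnergy i b r (fun w => Φ mn.1 w - Φ mn.2 w) w ^ ((p : ℝ) / 2) ∂μ) +
        ∫⁻ w, totalEnergy i b r (fun w => Ψ mn.1 w - Ψ mn.2 w) w ^ ((p : ℝ) / 2) ∂μ))) atTop
        (𝓝 0) := by
      have hc : (2 : ℝ≥0∞) ^ ((p : ℝ) / 2) ≠ ∞ := ENNReal.rpow_ne_top_of_nonneg hq (by simp)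
      simpa using ENNReal.Tendsto.const_mul (ENNReal.Tendsto.const_mul
        (hF.cauchy.add hG.cauchy) (.inr hc)) (.inr hc)
    refine tendsto_of_tendsto_of_tendsto_of_le_of_le tendsto_const_nhds hlim (fun _ => zero_le)
      fun mn => ?_
    have c1 := (hF.cyl mn.1).sub (hF.cyl mn.2)
    have c2 := (hG.cyl mn.1).sub (hG.cyl mn.2)
    have m1 := (measurable_totalEnergy i b r c1).pow_const ((p : ℝ) / 2)
    have m2 := (measurable_totalEnergy i b r c2).pow_const ((p : ℝ) / 2)
    dsimp only
    rw [← lintegral_const_mul_const_mul_add m1 m2]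
    refine lintegral_mono fun w => ?_
    have e : (fun w => Φ mn.1 w + Ψ mn.1 w - (Φ mn.2 w + Ψ mn.2 w)) =
        fun w => (Φ mn.1 w - Φ mn.2 w) + (Ψ mn.1 w - Ψ mn.2 w) := by
      ext w
      ring
    dsimp only
    rw [e]
    have h1 := totalEnergy_add_le i b r c1 c2 w
    rw [← mul_add] at h1
    refine (ENNReal.rpow_le_rpow h1 hq).trans ?_
    rw [ENNReal.mul_rpow_of_nonneg _ _ hq]
    gcongr
    exact add_rpow_le _ _ hq

/-- Keeping the same sequence Φ while lowering order and exponent is what lets one sequence serve at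
both levels of a nested bracket. -/
theorem of_two_mul [IsProbabilityMeasure μ] (hF : SobolevApprox i b μ r (2 * p) F Φ)
    (hsr : s ≤ r) : SobolevApprox i b μ s p F Φ where
  cyl := hF.cyl
  aestronglyMeasurable := hF.aestronglyMeasurable
  tendsto := by
    refine tendsto_of_tendsto_of_tendsto_of_le_of_le tendsto_const_nhds hF.tendsto
      (fun _ => zero_le) fun n => ?_
    refine eLpNorm_le_eLpNorm_of_exponent_le ?_
      ((hF.cyl n).continuous.measurable.aestronglyMeasurable.sub hF.aestronglyMeasurable)
    exact_mod_cast le_mul_of_one_le_left zero_le one_le_two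
  cauchy := by
    refine tendsto_of_tendsto_of_tendsto_of_le_of_le tendsto_const_nhds
      (tendsto_rpow_half hF.cauchy) (fun _ => zero_le) fun mn => ?_
    have c1 := (hF.cyl mn.1).sub (hF.cyl mn.2)
    calc _ ≤ ∫⁻ w, totalEnergy i b r (fun w => Φ mn.1 w - Φ mn.2 w) w ^ ((p : ℝ) / 2) ∂μ :=
          lintegral_mono fun w =>
            ENNReal.rpow_le_rpow (totalEnergy_mono i b hsr _ w) (by positivity)
      _ ≤ _ := lintegral_rpow_le_sqrt (measurable_totalEnergy i b r c1) (by positivity)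
      _ = _ := by
        congr! 4
        push_cast
        ring

variable [CompleteSpace H] [CompleteSpace W] [SecondCountableTopology W]

/-- A Cauchy sequence is eventually bounded: it is compared with one fixed member, whose energy has
finite moments by polynomial growth. -/
theorem exists_eventually_lintegral_le [IsGaussian μ] (hF : SobolevApprox i b μ r p F Φ) :
    ∃ M : ℝ≥0∞, M ≠ ∞ ∧
      ∀ᶠ n in atTop, ∫⁻ w, totalEnergy i b r (Φ n) w ^ ((p : ℝ) / 2) ∂μ ≤ M := by
  have hq : 0 ≤ (p : ℝ) / 2 := by positivity
  obtain ⟨⟨N₁, N₂⟩, hN⟩ := eventually_atTop.1 (hF.cauchy.eventually (gt_mem_nhds one_pos))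
  set K := ∫⁻ w, totalEnergy i b r (Φ N₂) w ^ ((p : ℝ) / 2) ∂μ
  have hK : K ≠ ∞ := ((polyBounded_totalEnergy i b r (hF.cyl N₂)).lintegral_rpow_lt_top hq).ne
  have hc : (2 : ℝ≥0∞) ^ ((p : ℝ) / 2) ≠ ∞ := ENNReal.rpow_ne_top_of_nonneg hq (by simp)
  refine ⟨2 ^ ((p : ℝ) / 2) * (2 ^ ((p : ℝ) / 2) * (1 + K)),
    ENNReal.mul_ne_top hc (ENNReal.mul_ne_top hc (by simp [hK])), ?_⟩
  filter_upwards [eventually_ge_atTop N₁] with n hn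
  have c1 := (hF.cyl n).sub (hF.cyl N₂)
  have m1 := (measurable_totalEnergy i b r c1).pow_const ((p : ℝ) / 2)
  have m2 := (measurable_totalEnergy i b r (hF.cyl N₂)).pow_const ((p : ℝ) / 2)
  calc _ ≤ ∫⁻ w, 2 ^ ((p : ℝ) / 2) * (2 ^ ((p : ℝ) / 2) *
        (totalEnergy i b r (fun w => Φ n w - Φ N₂ w) w ^ ((p : ℝ) / 2) +
          totalEnergy i b r (Φ N₂) w ^ ((p : ℝ) / 2))) ∂μ := by
        refine lintegral_mono fun w => ?_
        have h1 := totalEnergy_add_le i b r c1 (hF.cyl N₂) w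
        simp only [sub_add_cancel] at h1
        rw [← mul_add] at h1
        refine (ENNReal.rpow_le_rpow h1 hq).trans ?_
        rw [ENNReal.mul_rpow_of_nonneg _ _ hq]
        gcongr
        exact add_rpow_le _ _ hq
    _ = 2 ^ ((p : ℝ) / 2) * (2 ^ ((p : ℝ) / 2) *
        ((∫⁻ w, totalEnergy i b r (fun w => Φ n w - Φ N₂ w) w ^ ((p : ℝ) / 2) ∂μ) + K)) := by
        rw [lintegral_const_mul_const_mul_add m1 m2]
    _ ≤ _ := by
        gcongr
        exact (hN (n, N₂) ⟨hn, le_rfl⟩).le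

/-- The energy of a pairing is bounded by a product of energies, and Cauchy–Schwarz splits the
integral of this product at the price of doubling the exponent. In each term one factor is an
increment tending to 0 and the other stays bounded. -/
theorem pairing_cauchy [IsGaussian μ] {C : ℝ≥0∞} {β : (W → ℝ) → (W → ℝ) → W → ℝ}
    (hβ : IsDerivationPairing i b s C β) (hC : C ≠ ∞)
    (hF : SobolevApprox i b μ (r + s) (2 * p) F Φ) (hG : SobolevApprox i b μ (r + s) (2 * p) G Ψ) :
    Tendsto (fun mn : ℕ × ℕ => ∫⁻ w, totalEnergy i b r
      (fun w => β (Φ mn.1) (Ψ mn.1) w - β (Φ mn.2) (Ψ mn.2) w) w ^ ((p : ℝ) / 2) ∂μ) atTop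
      (𝓝 0) := by
  set q : ℝ := (p : ℝ) / 2 with hq'
  have hq : 0 ≤ q := by positivity
  have h2q : ((2 * p : ℝ≥0) : ℝ) / 2 = 2 * q := by rw [hq']; push_cast; ring
  have cF := hF.cauchy
  have cG := hG.cauchy
  obtain ⟨M, hM, hFM⟩ := hF.exists_eventually_lintegral_le
  obtain ⟨M', hM', hGM⟩ := hG.exists_eventually_lintegral_le
  rw [h2q] at cF cG hFM hGM
  set D : ℝ≥0∞ := (r + 1) * 4 ^ r * C
  have hD : D ≠ ∞ := ENNReal.mul_ne_top (ENNReal.mul_ne_top (by simp) (by simp)) hC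
  have hc : (2 * D) ^ q ≠ ∞ :=
    ENNReal.rpow_ne_top_of_nonneg hq (ENNReal.mul_ne_top (by simp) hD)
  have hc2 : (2 : ℝ≥0∞) ^ q ≠ ∞ := ENNReal.rpow_ne_top_of_nonneg hq (by simp)
  have half : ∀ {x : ℝ≥0∞}, x ≠ ∞ → x ^ (1 / 2 : ℝ) ≠ ∞ := fun hx =>
    ENNReal.rpow_ne_top_of_nonneg (by positivity) hx
  let A : ℕ × ℕ → W → ℝ≥0∞ := fun mn => totalEnergy i b (r + s) fun w => Φ mn.1 w - Φ mn.2 w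
  let B : ℕ × ℕ → W → ℝ≥0∞ := fun mn => totalEnergy i b (r + s) fun w => Ψ mn.1 w - Ψ mn.2 w
  have hlim : Tendsto (fun mn : ℕ × ℕ => (2 * D) ^ q * (2 ^ q *
      ((∫⁻ w, A mn w ^ (2 * q) ∂μ) ^ (1 / 2 : ℝ) * M' ^ (1 / 2 : ℝ) +
        M ^ (1 / 2 : ℝ) * (∫⁻ w, B mn w ^ (2 * q) ∂μ) ^ (1 / 2 : ℝ)))) atTop (𝓝 0) := by
    have t1 := ENNReal.Tendsto.mul_const (b := M' ^ (1 / 2 : ℝ)) (tendsto_rpow_half cF)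
      (.inr (half hM'))
    have t2 := ENNReal.Tendsto.const_mul (a := M ^ (1 / 2 : ℝ)) (tendsto_rpow_half cG)
      (.inr (half hM))
    simpa using ENNReal.Tendsto.const_mul (ENNReal.Tendsto.const_mul (t1.add t2) (.inr hc2))
      (.inr hc)
  -- As a product filter, `atTop` on pairs allows the bounds on Φ_n and Ψ_m to hold eventually in
  -- each index separately.
  rw [← prod_atTop_atTop_eq] at hlim ⊢
  refine tendsto_of_tendsto_of_tendsto_of_le_of_le' tendsto_const_nhds hlim
    (Eventually.of_forall fun _ => zero_le) ?_
  filter_upwards [tendsto_snd.eventually hFM, tendsto_fst.eventually hGM] with mn h1 h2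
  have cA := (hF.cyl mn.1).sub (hF.cyl mn.2)
  have cB := (hG.cyl mn.1).sub (hG.cyl mn.2)
  have mA : Measurable (A mn) := measurable_totalEnergy i b _ cA
  have mB : Measurable (B mn) := measurable_totalEnergy i b _ cB
  have mF := measurable_totalEnergy i b (r + s) (hF.cyl mn.2)
  have mG := measurable_totalEnergy i b (r + s) (hG.cyl mn.1)
  have n1 := (mA.mul mG).pow_const q
  have n2 := (mF.mul mB).pow_const q
  calc _ ≤ ∫⁻ w, (2 * D) ^ q * (2 ^ q * ((A mn w * totalEnergy i b (r + s) (Ψ mn.1) w) ^ q +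
        (totalEnergy i b (r + s) (Φ mn.2) w * B mn w) ^ q)) ∂μ := by
        refine lintegral_mono fun w => ?_
        -- This telescoping leaves Ψ at the first index and Φ at the second, which are the two
        -- families bounded above.
        have e : (fun w => β (Φ mn.1) (Ψ mn.1) w - β (Φ mn.2) (Ψ mn.2) w) = fun w =>
            β (fun w => Φ mn.1 w - Φ mn.2 w) (Ψ mn.1) w +
              β (Φ mn.2) (fun w => Ψ mn.1 w - Ψ mn.2 w) w := by
          ext w
          rw [hβ.sub_left (hF.cyl _) (hF.cyl _), hβ.sub_right (hG.cyl _) (hG.cyl _)]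
          ring
        have b1 := totalEnergy_add_le i b r (hβ.isSmoothCylindrical cA (hG.cyl mn.1))
          (hβ.isSmoothCylindrical (hF.cyl mn.2) cB) w
        rw [← e] at b1
        have b2 : totalEnergy i b r (fun w => β (Φ mn.1) (Ψ mn.1) w - β (Φ mn.2) (Ψ mn.2) w) w ≤
            (2 * D) * (A mn w * totalEnergy i b (r + s) (Ψ mn.1) w +
              totalEnergy i b (r + s) (Φ mn.2) w * B mn w) := by
          refine b1.trans ((add_le_add
            (mul_le_mul_right (hβ.totalEnergy_le r cA (hG.cyl mn.1) w) 2)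
            (mul_le_mul_right (hβ.totalEnergy_le r (hF.cyl mn.2) cB w) 2)).trans (le_of_eq ?_))
          simp only [A, B, D]
          ring
        refine (ENNReal.rpow_le_rpow b2 hq).trans ?_
        rw [ENNReal.mul_rpow_of_nonneg _ _ hq]
        gcongr
        exact add_rpow_le _ _ hq
    _ = (2 * D) ^ q * (2 ^ q * ((∫⁻ w, (A mn w * totalEnergy i b (r + s) (Ψ mn.1) w) ^ q ∂μ) +
        ∫⁻ w, (totalEnergy i b (r + s) (Φ mn.2) w * B mn w) ^ q ∂μ)) := by
        exact lintegral_const_mul_const_mul_add n1 n2 _ _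
    _ ≤ _ := by
        gcongr
        · refine (lintegral_mul_rpow_le mA mG hq).trans ?_
          gcongr
        · refine (lintegral_mul_rpow_le mF mB hq).trans ?_
          gcongr

omit [CompleteSpace H] in
theorem memLp [IsGaussian μ] (hF : SobolevApprox i b μ r p F Φ) : MemLp F p μ :=
  memLp_of_tendsto_eLpNorm (fun n => (hF.cyl n).memLp (by simp)) hF.aestronglyMeasurable hF.tendsto

theorem mul [IsGaussian μ] (hp : 1 ≤ p) (hF : SobolevApprox i b μ r (2 * p) F Φ)
    (hG : SobolevApprox i b μ r (2 * p) G Ψ) :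
    SobolevApprox i b μ r p (fun w => F w * G w) fun n w => Φ n w * Ψ n w where
  cyl n := (hF.cyl n).mul (hG.cyl n)
  aestronglyMeasurable := hF.aestronglyMeasurable.mul hG.aestronglyMeasurable
  tendsto := by
    have := holderTriple_two_mul p
    have t := tendsto_eLpNorm_bilin (ContinuousLinearMap.mul ℝ ℝ) (r := (p : ℝ≥0∞))
      (by exact_mod_cast hp) (fun n => ((hF.cyl n).continuous.aestronglyMeasurable (μ := μ)))
      (fun n => ((hG.cyl n).continuous.aestronglyMeasurable (μ := μ))) hF.memLp hG.memLp
      hF.tendsto hG.tendsto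
    simpa only [ContinuousLinearMap.mul_apply'] using t
  cauchy := by
    have t := pairing_cauchy (isDerivationPairing_mul i b) ENNReal.one_ne_top (r := r) hF hG
    exact t

end SobolevApprox

end Approximation

theorem exists_tendsto_eLpNorm_of_cauchy {Ω E : Type*} [MeasurableSpace Ω] {μ : Measure Ω}
    [NormedAddCommGroup E] [CompleteSpace E] {p : ℝ≥0∞} (hp : 1 ≤ p) {f : ℕ → Ω → E}
    (hf : ∀ n, MemLp (f n) p μ)
    (hc : Tendsto (fun mn : ℕ × ℕ => eLpNorm (fun w => f mn.1 w - f mn.2 w) p μ) atTop (𝓝 0)) :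
    ∃ u, MemLp u p μ ∧ Tendsto (fun n => eLpNorm (fun w => f n w - u w) p μ) atTop (𝓝 0) := by
  have : Fact (1 ≤ p) := ⟨hp⟩
  have hcau : CauchySeq fun n => (hf n).toLp (f n) := by
    rw [cauchySeq_iff_tendsto_dist_atTop_0]
    have e : ∀ mn : ℕ × ℕ, dist ((hf mn.1).toLp (f mn.1)) ((hf mn.2).toLp (f mn.2)) =
        (eLpNorm (fun w => f mn.1 w - f mn.2 w) p μ).toReal := fun mn => by
      rw [dist_eq_norm, ← MemLp.toLp_sub, Lp.norm_toLp]
      rfl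
    simp_rw [e]
    simpa [Function.comp_def] using (ENNReal.tendsto_toReal ENNReal.zero_ne_top).comp hc
  obtain ⟨g, hg⟩ := cauchySeq_tendsto_of_complete hcau
  refine ⟨g, Lp.memLp g, ?_⟩
  rw [Lp.tendsto_Lp_iff_tendsto_eLpNorm'] at hg
  refine hg.congr fun n => eLpNorm_congr_ae ?_
  filter_upwards [(hf n).coeFn_toLp] with w hw
  simp [hw]

/-! ### The Malliavin gradient and its rules of calculus. -/

section MalliavinGradient

variable {H W ι : Type*} [NormedAddCommGroup H] [InnerProductSpace ℝ H] [CompleteSpace H]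
  [SecondCountableTopology H] [NormedAddCommGroup W] [NormedSpace ℝ W] [CompleteSpace W]
  [SecondCountableTopology W] [MeasurableSpace W] [BorelSpace W]
  {i : H →L[ℝ] W} {b : HilbertBasis ι ℝ H} {μ : Measure W}

omit [CompleteSpace W] [SecondCountableTopology W] [SecondCountableTopology H] [BorelSpace W] in
theorem eLpNorm_cylGrad_sub_le {r : ℕ} (hr : 1 ≤ r) {p : ℝ≥0} (hp : 1 ≤ p) {Φ Ψ : W → ℝ}
    (hΦ : IsSmoothCylindrical Φ) (hΨ : IsSmoothCylindrical Ψ) :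
    eLpNorm (fun w => cylGrad i Φ w - cylGrad i Ψ w) p μ ≤
      (∫⁻ w, totalEnergy i b r (fun w => Φ w - Ψ w) w ^ ((p : ℝ) / 2) ∂μ) ^ (1 / (p : ℝ)) := by
  have hp0 : (p : ℝ≥0∞) ≠ 0 := by exact_mod_cast (one_pos.trans_le hp).ne'
  rw [eLpNorm_eq_lintegral_rpow_enorm_toReal hp0 (by simp), ENNReal.coe_toReal]
  gcongr with w
  rw [← cylGrad_sub i hΦ hΨ]
  calc ‖cylGrad i (fun w => Φ w - Ψ w) w‖ₑ ^ (p : ℝ)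
      = (‖cylGrad i (fun w => Φ w - Ψ w) w‖ₑ ^ 2) ^ ((p : ℝ) / 2) := by
        rw [← ENNReal.rpow_natCast, ← ENNReal.rpow_mul]
        congr 1
        push_cast
        ring
    _ ≤ _ := by
        rw [← energy_one i b]
        exact ENNReal.rpow_le_rpow (energy_le_totalEnergy i b hr _ w) (by positivity)

variable {r : ℕ} {p : ℝ≥0} {F G : W → ℝ} {Φ Ψ : ℕ → W → ℝ}

/-- Subtracting two approximating sequences gives a null sequence whose gradients converge to u − v,
so closability applies. -/
theorem isMalliavinGradient_unique (h : IsWienerSpace i μ) {u v : W → H}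
    (hu : IsMalliavinGradient i μ F u) (hv : IsMalliavinGradient i μ F v)
    (hF : AEStronglyMeasurable F μ) : u =ᵐ[μ] v := by
  have := h.isGaussian
  obtain ⟨hum, Φ, hΦ, hΦF, hΦu⟩ := hu
  obtain ⟨hvm, Ψ, hΨ, hΨF, hΨv⟩ := hv
  simp_rw [gradient_eq_cylGrad i (hΦ _)] at hΦu
  simp_rw [gradient_eq_cylGrad i (hΨ _)] at hΨv
  have key := h.ae_eq_zero_of_tendsto_cylGrad (u := fun w => u w - v w)
    (fun n => (hΦ n).sub (hΨ n)) (hum.sub hvm) ?_ ?_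
  · filter_upwards [key] with w hw
    exact sub_eq_zero.1 hw
  · refine tendsto_of_tendsto_of_tendsto_of_le_of_le tendsto_const_nhds
      (by simpa using hΦF.add hΨF) (fun _ => zero_le) fun n => ?_
    have e : (fun w => Φ n w - Ψ n w) = (Φ n - F) - (Ψ n - F) := by ext w; simp
    dsimp only
    rw [e]
    exact eLpNorm_sub_le ((hΦ n).continuous.aestronglyMeasurable.sub hF)
      ((hΨ n).continuous.aestronglyMeasurable.sub hF) (by simp)
  · refine tendsto_of_tendsto_of_tendsto_of_le_of_le tendsto_const_nhds
      (by simpa using hΦu.add hΨv) (fun _ => zero_le) fun n => ?_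
    have e : (fun w => cylGrad i (fun w => Φ n w - Ψ n w) w - (u w - v w)) =
        (fun w => cylGrad i (Φ n) w - u w) - fun w => cylGrad i (Ψ n) w - v w := by
      ext1 w
      simp only [Pi.sub_apply, cylGrad_sub i (hΦ n) (hΨ n)]
      abel
    dsimp only
    rw [e]
    exact eLpNorm_sub_le (((hΦ n).cylGrad i).continuous.aestronglyMeasurable.sub hum)
      (((hΨ n).cylGrad i).continuous.aestronglyMeasurable.sub hvm) (by simp)

/-- Gradients form a Cauchy sequence in L^p, and for p ≥ 2 their limit is also an L² limit. By
uniqueness it agrees almost everywhere with the gradient picked by choice. -/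
theorem SobolevApprox.memLp_malliavinGradient (h : IsWienerSpace i μ)
    (hF : SobolevApprox i b μ r p F Φ) (hr : 1 ≤ r) (hp : 2 ≤ p) :
    MemLp (malliavinGradient i μ F) p μ ∧ Tendsto (fun n => eLpNorm
      (fun w => cylGrad i (Φ n) w - malliavinGradient i μ F w) p μ) atTop (𝓝 0) := by
  have := h.isGaussian
  have hp1 : 1 ≤ p := one_le_two.trans hp
  have hp0 : (0 : ℝ) < p := by exact_mod_cast one_pos.trans_le hp1
  have hcyl := fun n => ((hF.cyl n).cylGrad i)
  obtain ⟨u, hu, hut⟩ := exists_tendsto_eLpNorm_of_cauchy (μ := μ) (p := p)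
    (by exact_mod_cast hp1) (fun n => (hcyl n).memLp (by simp)) (by
      have hlim : Tendsto (fun mn : ℕ × ℕ => (∫⁻ w, totalEnergy i b r
          (fun w => Φ mn.1 w - Φ mn.2 w) w ^ ((p : ℝ) / 2) ∂μ) ^ (1 / (p : ℝ))) atTop (𝓝 0) := by
        have := (ENNReal.continuous_rpow_const (y := 1 / (p : ℝ))).tendsto 0 |>.comp hF.cauchy
        rwa [ENNReal.zero_rpow_of_pos (by positivity)] at this
      exact tendsto_of_tendsto_of_tendsto_of_le_of_le tendsto_const_nhds hlim (fun _ => zero_le)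
        fun mn => eLpNorm_cylGrad_sub_le hr hp1 (hF.cyl _) (hF.cyl _))
  have h2p : (2 : ℝ≥0∞) ≤ p := by exact_mod_cast hp
  have hmal : IsMalliavinGradient i μ F u := by
    refine ⟨hu.1, Φ, hF.cyl, ?_, ?_⟩
    · exact tendsto_of_tendsto_of_tendsto_of_le_of_le tendsto_const_nhds hF.tendsto
        (fun _ => zero_le) fun n => eLpNorm_le_eLpNorm_of_exponent_le h2p
          ((hF.cyl n).continuous.aestronglyMeasurable.sub hF.aestronglyMeasurable)
    · simp_rw [gradient_eq_cylGrad i (hF.cyl _)]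
      exact tendsto_of_tendsto_of_tendsto_of_le_of_le tendsto_const_nhds hut
        (fun _ => zero_le) fun n => eLpNorm_le_eLpNorm_of_exponent_le h2p
          ((hcyl n).continuous.aestronglyMeasurable.sub hu.1)
  have hex : ∃ u : W → H, IsMalliavinGradient i μ F u := ⟨u, hmal⟩
  have hae : u =ᵐ[μ] malliavinGradient i μ F := by
    rw [malliavinGradient, dif_pos hex]
    exact isMalliavinGradient_unique h hmal hex.choose_spec hF.aestronglyMeasurable
  refine ⟨hu.ae_eq hae, hut.congr fun n => eLpNorm_congr_ae ?_⟩
  filter_upwards [hae] with w hw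
  rw [hw]

variable (P : H →L[ℝ] H →L[ℝ] ℝ)

theorem SobolevApprox.bracket (h : IsWienerSpace i μ) (hp : 1 ≤ p)
    (hF : SobolevApprox i b μ (r + 1) (2 * p) F Φ) (hG : SobolevApprox i b μ (r + 1) (2 * p) G Ψ) :
    SobolevApprox i b μ r p
      (fun w => P (malliavinGradient i μ F w) (malliavinGradient i μ G w))
      fun n => cylBracket i P (Φ n) (Ψ n) := by
  have := h.isGaussian
  have h2 : 2 ≤ 2 * p := le_mul_of_one_le_right zero_le hp
  obtain ⟨mF, tF⟩ := hF.memLp_malliavinGradient h (by lia) h2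
  obtain ⟨mG, tG⟩ := hG.memLp_malliavinGradient h (by lia) h2
  have := holderTriple_two_mul p
  refine ⟨fun n => (isDerivationPairing_cylBracket i P b).isSmoothCylindrical (hF.cyl n)
    (hG.cyl n), P.aestronglyMeasurable_comp₂ mF.1 mG.1, ?_, ?_⟩
  · have t := tendsto_eLpNorm_bilin P (r := (p : ℝ≥0∞)) (by exact_mod_cast hp)
      (fun n => ((hF.cyl n).cylGrad i).continuous.aestronglyMeasurable (μ := μ))
      (fun n => ((hG.cyl n).cylGrad i).continuous.aestronglyMeasurable (μ := μ)) mF mG tF tG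
    exact t
  · have t := SobolevApprox.pairing_cauchy (isDerivationPairing_cylBracket i P b)
      (by simp) (r := r) hF hG
    exact t

theorem SobolevApprox.malliavinGradient_ae_eq (h : IsWienerSpace i μ)
    (hF : SobolevApprox i b μ r p F Φ) (hr : 1 ≤ r) (hp : 2 ≤ p) {u : W → H}
    (hu : AEStronglyMeasurable u μ) {q : ℝ≥0∞} (hq : 1 ≤ q) (hqp : q ≤ p)
    (ht : Tendsto (fun n => eLpNorm (fun w => cylGrad i (Φ n) w - u w) q μ) atTop (𝓝 0)) :
    malliavinGradient i μ F =ᵐ[μ] u := by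
  have := h.isGaussian
  obtain ⟨m, t⟩ := hF.memLp_malliavinGradient h hr hp
  have hc := fun n => (((hF.cyl n).cylGrad i).continuous.aestronglyMeasurable (μ := μ))
  refine ae_eq_of_tendsto_eLpNorm hq hc m.1 hu ?_ ht
  exact tendsto_of_tendsto_of_tendsto_of_le_of_le tendsto_const_nhds t (fun _ => zero_le)
    fun n => eLpNorm_le_eLpNorm_of_exponent_le hqp ((hc n).sub m.1)

theorem malliavinGradient_add (h : IsWienerSpace i μ) (hF : MemWInfty i μ F)
    (hG : MemWInfty i μ G) : malliavinGradient i μ (fun w => F w + G w) =ᵐ[μ]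
      fun w => malliavinGradient i μ F w + malliavinGradient i μ G w := by
  have := h.isGaussian
  obtain ⟨Φ, hΦ⟩ := exists_sobolevApprox hF 1 one_le_two
  obtain ⟨Ψ, hΨ⟩ := exists_sobolevApprox hG 1 one_le_two
  obtain ⟨mF, tF⟩ := hΦ.memLp_malliavinGradient h le_rfl le_rfl
  obtain ⟨mG, tG⟩ := hΨ.memLp_malliavinGradient h le_rfl le_rfl
  refine (hΦ.add hΨ one_le_two).malliavinGradient_ae_eq h le_rfl le_rfl (mF.1.add mG.1)
    (q := 2) (by simp) (by simp) ?_
  refine tendsto_of_tendsto_of_tendsto_of_le_of_le tendsto_const_nhds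
    (by simpa using tF.add tG) (fun _ => zero_le) fun n => ?_
  have e : (fun w => cylGrad i (fun w => Φ n w + Ψ n w) w -
      (malliavinGradient i μ F w + malliavinGradient i μ G w)) =
      (fun w => cylGrad i (Φ n) w - malliavinGradient i μ F w) +
        fun w => cylGrad i (Ψ n) w - malliavinGradient i μ G w := by
    ext1 w
    simp only [Pi.add_apply, cylGrad_add i (hΦ.cyl n) (hΨ.cyl n)]
    abel
  simp only [Pi.add_def] at e ⊢
  rw [e]
  exact eLpNorm_add_le (((hΦ.cyl n).cylGrad i).continuous.aestronglyMeasurable.sub mF.1)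
    (((hΨ.cyl n).cylGrad i).continuous.aestronglyMeasurable.sub mG.1) (by simp)

theorem malliavinGradient_mul (h : IsWienerSpace i μ) (hF : MemWInfty i μ F)
    (hG : MemWInfty i μ G) : malliavinGradient i μ (fun w => F w * G w) =ᵐ[μ]
      fun w => F w • malliavinGradient i μ G w + G w • malliavinGradient i μ F w := by
  have := h.isGaussian
  -- Exponent 4 puts the products of functionals with gradients in L², the least exponent at which
  -- the gradient is identified.
  obtain ⟨Φ, hΦ⟩ := exists_sobolevApprox hF 1 (p := 2 * 2) (by norm_num)
  obtain ⟨Ψ, hΨ⟩ := exists_sobolevApprox hG 1 (p := 2 * 2) (by norm_num)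
  have h22 : (2 : ℝ≥0) ≤ 2 * 2 := by norm_num
  obtain ⟨mF, tF⟩ := hΦ.memLp_malliavinGradient h le_rfl h22
  obtain ⟨mG, tG⟩ := hΨ.memLp_malliavinGradient h le_rfl h22
  have := holderTriple_two_mul 2
  let B : ℝ →L[ℝ] H →L[ℝ] H := ContinuousLinearMap.lsmul ℝ ℝ
  have t1 := tendsto_eLpNorm_bilin B (r := ((2 : ℝ≥0) : ℝ≥0∞)) (by simp)
    (fun n => ((hΦ.cyl n).continuous.aestronglyMeasurable (μ := μ)))
    (fun n => (((hΨ.cyl n).cylGrad i).continuous.aestronglyMeasurable (μ := μ)))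
    hΦ.memLp mG hΦ.tendsto tG
  have t2 := tendsto_eLpNorm_bilin B (r := ((2 : ℝ≥0) : ℝ≥0∞)) (by simp)
    (fun n => ((hΨ.cyl n).continuous.aestronglyMeasurable (μ := μ)))
    (fun n => (((hΦ.cyl n).cylGrad i).continuous.aestronglyMeasurable (μ := μ)))
    hΨ.memLp mF hΨ.tendsto tF
  have a1 := B.aestronglyMeasurable_comp₂ hΦ.aestronglyMeasurable mG.1
  have a2 := B.aestronglyMeasurable_comp₂ hΨ.aestronglyMeasurable mF.1
  refine (hΦ.mul one_le_two hΨ).malliavinGradient_ae_eq h le_rfl le_rfl (a1.add a2)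
    (q := ((2 : ℝ≥0) : ℝ≥0∞)) (by simp) le_rfl ?_
  refine tendsto_of_tendsto_of_tendsto_of_le_of_le tendsto_const_nhds
    (by simpa using t1.add t2) (fun _ => zero_le) fun n => ?_
  have e : (fun w => cylGrad i (fun w => Φ n w * Ψ n w) w -
      (F w • malliavinGradient i μ G w + G w • malliavinGradient i μ F w)) =
      (fun w => B (Φ n w) (cylGrad i (Ψ n) w) - B (F w) (malliavinGradient i μ G w)) +
        fun w => B (Ψ n w) (cylGrad i (Φ n) w) - B (G w) (malliavinGradient i μ F w) := by
    ext1 w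
    simp only [Pi.add_apply, cylGrad_mul i (hΦ.cyl n) (hΨ.cyl n), B,
      ContinuousLinearMap.lsmul_apply]
    abel
  dsimp only
  rw [e]
  refine eLpNorm_add_le ?_ ?_ (by simp)
  · exact (B.aestronglyMeasurable_comp₂ (hΦ.cyl n).continuous.aestronglyMeasurable
      ((hΨ.cyl n).cylGrad i).continuous.aestronglyMeasurable).sub a1
  · exact (B.aestronglyMeasurable_comp₂ (hΨ.cyl n).continuous.aestronglyMeasurable
      ((hΦ.cyl n).cylGrad i).continuous.aestronglyMeasurable).sub a2

theorem malliavinGradient_const (h : IsWienerSpace i μ) (c : ℝ) :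
    malliavinGradient i μ (fun _ => c) =ᵐ[μ] 0 := by
  have := h.isGaussian
  refine (SobolevApprox.const (b := (exists_hilbertBasis ℝ H).choose_spec.choose) (r := 1) (p := 2)
    c one_le_two).malliavinGradient_ae_eq h le_rfl le_rfl aestronglyMeasurable_const (q := 2)
    (by simp) (by simp) ?_
  have : ∀ w, cylGrad i (fun _ : W => c) w = 0 := fun w => by simp [cylGrad]
  simp [this]

end MalliavinGradient

/-! ### Stability of W_{∞-} and the Jacobi identity. -/

section Algebra

variable {H W : Type*} [NormedAddCommGroup H] [InnerProductSpace ℝ H] [CompleteSpace H]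
  [NormedAddCommGroup W] [NormedSpace ℝ W] [MeasurableSpace W]
  {i : H →L[ℝ] W} {μ : Measure W} {F G : W → ℝ}

theorem memWInfty_const (c : ℝ) : MemWInfty i μ fun _ : W => c :=
  memWInfty_of_sobolevApprox aestronglyMeasurable_const fun _ _ hp =>
    ⟨_, SobolevApprox.const c hp⟩

variable [BorelSpace W]

theorem MemWInfty.congr (hF : MemWInfty i μ F) (h : F =ᵐ[μ] G) : MemWInfty i μ G :=
  memWInfty_of_sobolevApprox (hF.1.congr h) fun r _ hp =>
    (exists_sobolevApprox hF r hp).imp fun _ hΦ => hΦ.congr h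

theorem MemWInfty.add (hF : MemWInfty i μ F) (hG : MemWInfty i μ G) :
    MemWInfty i μ fun w => F w + G w :=
  memWInfty_of_sobolevApprox (hF.1.add hG.1) fun r p hp => by
    obtain ⟨Φ, hΦ⟩ := exists_sobolevApprox hF r hp
    obtain ⟨Ψ, hΨ⟩ := exists_sobolevApprox hG r hp
    exact ⟨_, hΦ.add hΨ hp⟩

variable [CompleteSpace W] [SecondCountableTopology W]

theorem MemWInfty.mul (h : IsWienerSpace i μ) (hF : MemWInfty i μ F) (hG : MemWInfty i μ G) :
    MemWInfty i μ fun w => F w * G w :=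
  memWInfty_of_sobolevApprox (hF.1.mul hG.1) fun r p hp => by
    have := h.isGaussian
    have h2 : 1 ≤ 2 * p := hp.trans (le_mul_of_one_le_left zero_le one_le_two)
    obtain ⟨Φ, hΦ⟩ := exists_sobolevApprox hF r h2
    obtain ⟨Ψ, hΨ⟩ := exists_sobolevApprox hG r h2
    exact ⟨_, hΦ.mul hp hΨ⟩

variable [SecondCountableTopology H] (P : H →L[ℝ] H →L[ℝ] ℝ)

theorem MemWInfty.bracket (h : IsWienerSpace i μ) (hF : MemWInfty i μ F) (hG : MemWInfty i μ G) :
    MemWInfty i μ fun w => P (malliavinGradient i μ F w) (malliavinGradient i μ G w) := by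
  have key : ∀ (r : ℕ) (p : ℝ≥0), 1 ≤ p → ∃ Φ, SobolevApprox i
      (exists_hilbertBasis ℝ H).choose_spec.choose μ r p
      (fun w => P (malliavinGradient i μ F w) (malliavinGradient i μ G w)) Φ := fun r p hp => by
    have h2 : 1 ≤ 2 * p := hp.trans (le_mul_of_one_le_left zero_le one_le_two)
    obtain ⟨Φ, hΦ⟩ := exists_sobolevApprox hF (r + 1) h2
    obtain ⟨Ψ, hΨ⟩ := exists_sobolevApprox hG (r + 1) h2
    exact ⟨_, hΦ.bracket P h hp hΨ⟩
  obtain ⟨Φ, hΦ⟩ := key 0 1 le_rfl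
  exact memWInfty_of_sobolevApprox hΦ.aestronglyMeasurable key

/-- The Jacobi sum of F, G, K is an L¹ limit of the Jacobi sums of the approximations, which vanish
identically. -/
theorem malliavin_jacobi (h : IsWienerSpace i μ) (hP : ∀ x y, P x y = -P y x) {F G K : W → ℝ}
    (hF : MemWInfty i μ F) (hG : MemWInfty i μ G) (hK : MemWInfty i μ K) :
    let br : (W → ℝ) → (W → ℝ) → W → ℝ := fun F G w =>
      P (malliavinGradient i μ F w) (malliavinGradient i μ G w)
    (fun w => br F (br G K) w + br G (br K F) w + br K (br F G) w) =ᵐ[μ] 0 := by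
  intro br
  have := h.isGaussian
  -- Two nested brackets cost two derivatives and two doublings of the exponent, whence order 2 and
  -- exponent 4.
  have h4 : (1 : ℝ≥0) ≤ 2 * (2 * 1) := by norm_num
  obtain ⟨Φ, hΦ⟩ := exists_sobolevApprox hF 2 h4
  obtain ⟨Ψ, hΨ⟩ := exists_sobolevApprox hG 2 h4
  obtain ⟨X, hX⟩ := exists_sobolevApprox hK 2 h4
  have h12 : 1 ≤ 2 := one_le_two
  have hp2 : (1 : ℝ≥0) ≤ 2 * 1 := by norm_num
  have s1 := (hΦ.of_two_mul h12).bracket P h (r := 0) le_rfl (hΨ.bracket P h (r := 1) hp2 hX)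
  have s2 := (hΨ.of_two_mul h12).bracket P h (r := 0) le_rfl (hX.bracket P h (r := 1) hp2 hΦ)
  have s3 := (hX.of_two_mul h12).bracket P h (r := 0) le_rfl (hΦ.bracket P h (r := 1) hp2 hΨ)
  have s := (s1.add s2 le_rfl).add s3 le_rfl
  refine ae_eq_of_tendsto_eLpNorm (p := 1) le_rfl
    (fun n => (s.cyl n).continuous.aestronglyMeasurable) s.aestronglyMeasurable
    aestronglyMeasurable_const s.tendsto ?_
  simp [cylBracket_jacobi i hP (hΦ.cyl _) (hΨ.cyl _) (hX.cyl _)]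

end Algebra

/-! ### Poisson Wiener spaces from constant skew forms. -/

section Poisson

variable {H W : Type*} [NormedAddCommGroup H] [InnerProductSpace ℝ H] [CompleteSpace H]
  [SecondCountableTopology H] [NormedAddCommGroup W] [NormedSpace ℝ W] [CompleteSpace W]
  [SecondCountableTopology W] [MeasurableSpace W] [BorelSpace W]
  {i : H →L[ℝ] W} {μ : Measure W}

omit [CompleteSpace H] [SecondCountableTopology H] [CompleteSpace W] [SecondCountableTopology W]
  [BorelSpace W] in
theorem isSobolev_const {E : Type*} [NormedAddCommGroup E] [NormedSpace ℝ E]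
    {N : ∀ j : ℕ, ((Fin j → H) → E) → ℝ≥0∞} (hN : ∀ j, N j (fun _ => 0) = 0) (c : E) :
    IsSobolev i μ N fun _ => c := by
  refine ⟨aestronglyMeasurable_const, fun r p hp => ⟨fun _ _ => c, fun _ => .const c, ?_, ?_⟩⟩
  · simp
  · intro j _
    have h0 : ∀ w, cylDeriv i j (0 : W → E) w = 0 := fun w =>
      congrFun (iteratedFDeriv_fun_zero (𝕜 := ℝ) (E := H) (F := E)) 0
    have : (0 : ℝ) < p := by exact_mod_cast one_pos.trans_le hp
    simp [h0, hN, this]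

omit [SecondCountableTopology H] [CompleteSpace W] [SecondCountableTopology W] [BorelSpace W] in
theorem isSobolevBilinForm_const (P : H →L[ℝ] H →L[ℝ] ℝ) :
    IsSobolevBilinForm i μ fun _ => P :=
  isSobolev_const (fun j => by simp [bilinNorm, hsNorm]) P

/-- The algebra of the functionals that belong to all the Sobolev spaces. -/
noncomputable def wInfty (h : IsWienerSpace i μ) : Subalgebra ℝ (W →ₘ[μ] ℝ) where
  carrier := {F | MemWInfty i μ F}
  mul_mem' {F G} hF hG := (MemWInfty.mul h hF hG).congr (AEEqFun.coeFn_mul F G).symm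
  add_mem' {F G} hF hG := (MemWInfty.add hF hG).congr (AEEqFun.coeFn_add F G).symm
  algebraMap_mem' c := by
    refine (memWInfty_const c).congr ?_
    rw [Algebra.algebraMap_eq_smul_one]
    filter_upwards [AEEqFun.coeFn_smul c (1 : W →ₘ[μ] ℝ), AEEqFun.coeFn_one (α := W) (β := ℝ)
      (μ := μ)] with w h1 h2
    simp [h1, h2]

/-- The gradient is chosen for each function, so independence of the representative must be proved;
both choices are limits of the same cylindrical gradients. -/
theorem malliavinGradient_congr (h : IsWienerSpace i μ) {F G : W → ℝ} (hF : MemWInfty i μ F)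
    (hFG : F =ᵐ[μ] G) : malliavinGradient i μ F =ᵐ[μ] malliavinGradient i μ G := by
  obtain ⟨Φ, hΦ⟩ := exists_sobolevApprox hF 1 one_le_two
  obtain ⟨mG, tG⟩ := (hΦ.congr hFG).memLp_malliavinGradient h le_rfl le_rfl
  exact hΦ.malliavinGradient_ae_eq h le_rfl le_rfl mG.1 (by simp) le_rfl tG

theorem malliavinGradient_coe_add (h : IsWienerSpace i μ) (F G : wInfty h) :
    malliavinGradient i μ ((F + G : wInfty h) : W →ₘ[μ] ℝ) =ᵐ[μ] fun w =>
      malliavinGradient i μ (F : W →ₘ[μ] ℝ) w + malliavinGradient i μ (G : W →ₘ[μ] ℝ) w :=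
  (malliavinGradient_congr h (F + G).2 (AEEqFun.coeFn_add _ _)).trans
    (malliavinGradient_add h F.2 G.2)

theorem malliavinGradient_coe_mul (h : IsWienerSpace i μ) (F G : wInfty h) :
    malliavinGradient i μ ((F * G : wInfty h) : W →ₘ[μ] ℝ) =ᵐ[μ] fun w =>
      (F : W →ₘ[μ] ℝ) w • malliavinGradient i μ (G : W →ₘ[μ] ℝ) w +
        (G : W →ₘ[μ] ℝ) w • malliavinGradient i μ (F : W →ₘ[μ] ℝ) w :=
  (malliavinGradient_congr h (F * G).2 (AEEqFun.coeFn_mul _ _)).trans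
    (malliavinGradient_mul h F.2 G.2)

theorem malliavinGradient_coe_smul (h : IsWienerSpace i μ) (c : ℝ) (F : wInfty h) :
    malliavinGradient i μ ((c • F : wInfty h) : W →ₘ[μ] ℝ) =ᵐ[μ] fun w =>
      c • malliavinGradient i μ (F : W →ₘ[μ] ℝ) w := by
  filter_upwards [malliavinGradient_congr h (c • F).2 (AEEqFun.coeFn_smul c (F : W →ₘ[μ] ℝ)),
    malliavinGradient_mul h (memWInfty_const c) F.2, malliavinGradient_const h c] with w h1 h2 h3
  rw [h1]
  simp only [h3, Pi.zero_apply, smul_zero, add_zero] at h2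
  exact h2

/-- The bracket on `W_{∞-}` given by a bilinear form on `H`. -/
noncomputable def wBracket (h : IsWienerSpace i μ) (P : H →L[ℝ] H →L[ℝ] ℝ) (F G : wInfty h) :
    wInfty h :=
  ⟨AEEqFun.mk _ (MemWInfty.bracket P h F.2 G.2).1,
    (MemWInfty.bracket P h F.2 G.2).congr (AEEqFun.coeFn_mk _ _).symm⟩

theorem coeFn_wBracket (h : IsWienerSpace i μ) (P : H →L[ℝ] H →L[ℝ] ℝ) (F G : wInfty h) :
    (wBracket h P F G : W →ₘ[μ] ℝ) =ᵐ[μ] fun w =>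
      P (malliavinGradient i μ (F : W →ₘ[μ] ℝ) w) (malliavinGradient i μ (G : W →ₘ[μ] ℝ) w) :=
  AEEqFun.coeFn_mk _ _

/-- The bracket on `W_{∞-}` given by a bilinear form on `H`, as a bilinear map. -/
noncomputable def wBracketHom (h : IsWienerSpace i μ) (P : H →L[ℝ] H →L[ℝ] ℝ) :
    wInfty h →ₗ[ℝ] wInfty h →ₗ[ℝ] wInfty h :=
  LinearMap.mk₂ ℝ (wBracket h P)
    (fun F F' G => by
      refine Subtype.ext (AEEqFun.ext ?_)
      filter_upwards [coeFn_wBracket h P (F + F') G, coeFn_wBracket h P F G,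
        coeFn_wBracket h P F' G, malliavinGradient_coe_add h F F',
        AEEqFun.coeFn_add (wBracket h P F G : W →ₘ[μ] ℝ) (wBracket h P F' G)] with w h1 h2 h3 h4 h5
      rw [h1, h4, Subalgebra.coe_add, h5, Pi.add_apply, h2, h3, map_add, add_apply])
    (fun c F G => by
      refine Subtype.ext (AEEqFun.ext ?_)
      filter_upwards [coeFn_wBracket h P (c • F) G, coeFn_wBracket h P F G,
        malliavinGradient_coe_smul h c F,
        AEEqFun.coeFn_smul c (wBracket h P F G : W →ₘ[μ] ℝ)] with w h1 h2 h3 h4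
      rw [h1, h3, Subalgebra.coe_smul, h4, Pi.smul_apply, h2, map_smul, smul_apply])
    (fun F G G' => by
      refine Subtype.ext (AEEqFun.ext ?_)
      filter_upwards [coeFn_wBracket h P F (G + G'), coeFn_wBracket h P F G,
        coeFn_wBracket h P F G', malliavinGradient_coe_add h G G',
        AEEqFun.coeFn_add (wBracket h P F G : W →ₘ[μ] ℝ) (wBracket h P F G')] with w h1 h2 h3 h4 h5
      rw [h1, h4, Subalgebra.coe_add, h5, Pi.add_apply, h2, h3, map_add])
    (fun c F G => by
      refine Subtype.ext (AEEqFun.ext ?_)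
      filter_upwards [coeFn_wBracket h P F (c • G), coeFn_wBracket h P F G,
        malliavinGradient_coe_smul h c G,
        AEEqFun.coeFn_smul c (wBracket h P F G : W →ₘ[μ] ℝ)] with w h1 h2 h3 h4
      rw [h1, h3, Subalgebra.coe_smul, h4, Pi.smul_apply, h2, map_smul])

theorem isPoissonBracket_wBracketHom (h : IsWienerSpace i μ) (P : H →L[ℝ] H →L[ℝ] ℝ)
    (hP : ∀ x y, P x y = -P y x) : IsPoissonBracket (wBracketHom h P) where
  antisymm F G := by
    refine Subtype.ext (AEEqFun.ext ?_)
    filter_upwards [coeFn_wBracket h P F G, coeFn_wBracket h P G F,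
      AEEqFun.coeFn_neg (wBracket h P G F : W →ₘ[μ] ℝ)] with w h1 h2 h3
    change (wBracket h P F G : W →ₘ[μ] ℝ) w = (-(wBracket h P G F : W →ₘ[μ] ℝ)) w
    rw [h1, h3, Pi.neg_apply, h2, hP]
  leibniz F G K := by
    refine Subtype.ext (AEEqFun.ext ?_)
    filter_upwards [coeFn_wBracket h P F (G * K), coeFn_wBracket h P F G, coeFn_wBracket h P F K,
      malliavinGradient_coe_mul h G K,
      AEEqFun.coeFn_add ((wBracket h P F G : W →ₘ[μ] ℝ) * (K : W →ₘ[μ] ℝ))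
        ((G : W →ₘ[μ] ℝ) * (wBracket h P F K : W →ₘ[μ] ℝ)),
      AEEqFun.coeFn_mul (wBracket h P F G : W →ₘ[μ] ℝ) K,
      AEEqFun.coeFn_mul (G : W →ₘ[μ] ℝ) (wBracket h P F K)] with w h1 h2 h3 h4 h5 h6 h7
    change (wBracket h P F (G * K) : W →ₘ[μ] ℝ) w =
      ((wBracket h P F G : W →ₘ[μ] ℝ) * (K : W →ₘ[μ] ℝ) +
        (G : W →ₘ[μ] ℝ) * (wBracket h P F K : W →ₘ[μ] ℝ)) w
    rw [h1, h4, h5, Pi.add_apply, h6, h7, Pi.mul_apply, Pi.mul_apply, h2, h3, map_add, map_smul,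
      map_smul, smul_eq_mul, smul_eq_mul]
    ring
  jacobi F G K := by
    refine Subtype.ext (AEEqFun.ext ?_)
    have e : ∀ F G K : wInfty h, (wBracket h P F (wBracket h P G K) : W →ₘ[μ] ℝ) =ᵐ[μ] fun w =>
        P (malliavinGradient i μ (F : W →ₘ[μ] ℝ) w) (malliavinGradient i μ (fun w =>
          P (malliavinGradient i μ (G : W →ₘ[μ] ℝ) w)
            (malliavinGradient i μ (K : W →ₘ[μ] ℝ) w)) w) := fun F G K => by
      filter_upwards [coeFn_wBracket h P F (wBracket h P G K), malliavinGradient_congr h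
        (wBracket h P G K).2 (coeFn_wBracket h P G K)] with w h1 h2
      rw [h1, h2]
    filter_upwards [e F G K, e G K F, e K F G, malliavin_jacobi P h hP F.2 G.2 K.2,
      AEEqFun.coeFn_add (wBracket h P F (wBracket h P G K) + wBracket h P G (wBracket h P K F) :
        W →ₘ[μ] ℝ) (wBracket h P K (wBracket h P F G)),
      AEEqFun.coeFn_add (wBracket h P F (wBracket h P G K) : W →ₘ[μ] ℝ)
        (wBracket h P G (wBracket h P K F)),
      AEEqFun.coeFn_zero (α := W) (β := ℝ) (μ := μ)] with w h1 h2 h3 h4 h5 h6 h7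
    change (wBracket h P F (wBracket h P G K) + wBracket h P G (wBracket h P K F) +
      wBracket h P K (wBracket h P F G) : W →ₘ[μ] ℝ) w = (0 : W →ₘ[μ] ℝ) w
    rw [h5, Pi.add_apply, h6, Pi.add_apply, h1, h2, h3, h7]
    exact h4

/-- A constant skew-symmetric form on `H` makes `W_{∞-}` a Poisson Wiener space. -/
theorem IsWienerSpace.isPoissonWienerSpace (h : IsWienerSpace i μ) (P : H →L[ℝ] H →L[ℝ] ℝ)
    (hP : ∀ x y, P x y = -P y x) {br : (W → ℝ) → (W → ℝ) → W → ℝ}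
    (hbr : ∀ F G w, br F G w = P (malliavinGradient i μ F w) (malliavinGradient i μ G w)) :
    IsPoissonWienerSpace i μ br where
  isWienerSpace := h
  isPoisson := by
    refine ⟨wInfty h, fun F => Iff.rfl, wBracketHom h P, isPoissonBracket_wBracketHom h P hP,
      fun F G => ?_, fun _ => P, isSobolevBilinForm_const P,
      fun F G => Eventually.of_forall fun w => hbr _ _ w⟩
    filter_upwards [coeFn_wBracket h P F G] with w hw
    rw [hbr]
    exact hw

end Poisson

/-! ### The classical Wiener measure and its product. -/

section ClassicalWiener

theorem primitive_apply (h : L2) (t : I) : primitive h t = ∫ u in Set.Iic t, h u := rfl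

theorem volume_real_Iic (t : I) : (volume : Measure I).real (Set.Iic t) = t := by
  simp [measureReal_def, unitInterval.volume_Iic, t.2.1]

/-- A vanishing primitive means vanishing integrals over the intervals `Set.Iic t`, a π-system
generating the Borel sets; hence h integrates to 0 over every Borel set. -/
theorem primitive_injective : Function.Injective primitive := by
  refine (injective_iff_map_eq_zero primitive).2 fun h hh => ?_
  have h0 : ∀ t : I, ∫ u in Set.Iic t, h u = 0 := fun t => by
    rw [← primitive_apply, hh, ContinuousMap.zero_apply]
  have h1 : ∫ u, h u = 0 := by
    have := h0 1
    rwa [show Set.Iic (1 : I) = Set.univ from Set.Iic_top, setIntegral_univ] at this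
  have key : ∀ s : Set I, MeasurableSet s → ∫ u in s, h u = 0 := by
    refine MeasurableSpace.induction_on_inter ((BorelSpace.measurable_eq (α := I)).trans
      (borel_eq_generateFrom_Iic I)) isPiSystem_Iic (by simp) ?_ ?_ ?_
    · rintro _ ⟨t, rfl⟩
      exact h0 t
    · intro s hs e
      rw [setIntegral_compl hs (integrable_L2 h), h1, e, sub_zero]
    · intro f hd hf e
      rw [integral_iUnion hf hd (integrable_L2 h).integrableOn]
      simp [e]
  rw [Lp.eq_zero_iff_ae_eq_zero]
  exact (integrable_L2 h).ae_eq_zero_of_forall_setIntegral_eq_zero fun s hs _ => key s hs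

theorem embed_injective : Function.Injective embed := fun x y hxy => by
  have h1 := primitive_injective (congrArg Prod.fst hxy)
  have h2 := primitive_injective (congrArg Prod.snd hxy)
  exact (WithLp.equiv 2 (L2 × L2)).injective (Prod.ext h1 h2)

/-- The linear combination of evaluations with coefficients `c`. -/
noncomputable def evalSum (c : I →₀ ℝ) : StrongDual ℝ C(I, ℝ) :=
  ∑ t ∈ c.support, c t • ContinuousMap.evalCLM ℝ t

theorem evalSum_apply (c : I →₀ ℝ) (w : C(I, ℝ)) :
    evalSum c w = ∑ t ∈ c.support, c t * w t := by
  simp [evalSum]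

theorem evalSum_eq_linearCombination (c : I →₀ ℝ) : evalSum c =
    Finsupp.linearCombination ℝ (fun t => (ContinuousMap.evalCLM ℝ t : StrongDual ℝ C(I, ℝ))) c :=
  rfl

theorem evalSum_sub (c d : I →₀ ℝ) : evalSum (c - d) = evalSum c - evalSum d := by
  simp_rw [evalSum_eq_linearCombination, map_sub]

/-- Evaluation of a primitive at t is the inner product with the indicator of [0, t], and two such
indicators have inner product min(s, t). This matches the Wiener covariance with the geometry of L².
-/
theorem norm_evalSum_comp_primitive_sq (c : I →₀ ℝ) :
    ‖evalSum c ∘L primitive‖ ^ 2 =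
      ∑ s ∈ c.support, ∑ t ∈ c.support, c s * (c t * min (s : ℝ) t) := by
  set g : L2 := ∑ t ∈ c.support, c t •
    indicatorConstLp 2 (measurableSet_Iic (a := t)) (measure_ne_top _ _) (1 : ℝ) with hg
  have e : evalSum c ∘L primitive = innerSL ℝ g := by
    ext h
    rw [ContinuousLinearMap.comp_apply, evalSum_apply, innerSL_apply_apply, hg, sum_inner]
    refine Finset.sum_congr rfl fun t _ => ?_
    rw [real_inner_smul_left, L2.inner_indicatorConstLp_one, primitive_apply]
  rw [e, innerSL_apply_norm, ← real_inner_self_eq_norm_sq, hg, sum_inner]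
  refine Finset.sum_congr rfl fun s _ => ?_
  rw [inner_sum]
  refine Finset.sum_congr rfl fun t _ => ?_
  rw [real_inner_smul_left, real_inner_smul_right,
    L2.real_inner_indicatorConstLp_one_indicatorConstLp_one, Set.Iic_inter_Iic, volume_real_Iic]
  rfl

variable [MeasurableSpace C(I, ℝ)] [BorelSpace C(I, ℝ)] {ν : Measure C(I, ℝ)}

theorem IsWienerMeasure.charFunDual_evalSum (hν : IsWienerMeasure ν) (c : I →₀ ℝ) :
    charFunDual ν (evalSum c) =
      Complex.exp (-((‖evalSum c ∘L primitive‖ : ℝ) : ℂ) ^ 2 / 2) := by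
  have := hν.isGaussianProcess.isProbabilityMeasure
  have hm : ∀ t, MemLp (fun w : C(I, ℝ) => w t) 2 ν := fun t =>
    (hν.isGaussianProcess.hasGaussianLaw_eval t).memLp_two
  have e : ⇑(evalSum c) = fun w : C(I, ℝ) => ∑ t ∈ c.support, c t • w t :=
    funext fun w => evalSum_apply c w
  have hG : HasGaussianLaw (evalSum c) ν := by
    rw [e]
    exact (hν.isGaussianProcess.smul c).hasGaussianLaw_fun_sum
  have hmean : ∫ w, evalSum c w ∂ν = 0 := by
    rw [e]
    refine (integral_finsetSum _ fun t _ => ((hm t).integrable one_le_two).smul (c t)).trans ?_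
    exact Finset.sum_eq_zero fun t _ => (integral_smul (c t) _).trans (by rw [hν.mean, smul_zero])
  have hvar : Var[evalSum c; ν] = ‖evalSum c ∘L primitive‖ ^ 2 := by
    rw [norm_evalSum_comp_primitive_sq, e]
    refine (variance_fun_sum' fun t _ => (hm t).const_smul (c t)).trans ?_
    refine Finset.sum_congr rfl fun s _ => Finset.sum_congr rfl fun t _ => ?_
    simp only [Pi.smul_def, smul_eq_mul]
    rw [covariance_const_mul_left, covariance_const_mul_right, hν.covariance]
  rw [charFunDual_eq_charFun_map_one, hG.map_eq_gaussianReal, charFun_gaussianReal, hmean, hvar,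
    Real.coe_toNNReal _ (sq_nonneg _)]
  congr 1
  push_cast
  ring

omit [MeasurableSpace C(I, ℝ)] [BorelSpace C(I, ℝ)] in
-- The Bernstein approximation of w depends on finitely many values of w, so ℓ applied to it is a
-- combination of evaluations; uniform convergence and continuity of ℓ do the rest.
theorem exists_tendsto_evalSum (ℓ : StrongDual ℝ C(I, ℝ)) :
    ∃ c : ℕ → I →₀ ℝ, ∀ w, Tendsto (fun n => evalSum (c n) w) atTop (𝓝 (ℓ w)) := by
  have h : ∀ n, ∃ c : I →₀ ℝ, ∀ w, evalSum c w = ℓ (bernsteinApproximation n w) := fun n => by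
    refine ⟨∑ k : Fin (n + 1), Finsupp.single (bernstein.z k) (ℓ (bernstein n k)), fun w => ?_⟩
    have e : bernsteinApproximation n w =
        ∑ k : Fin (n + 1), w (bernstein.z k) • bernstein n k := by
      ext x
      simp [bernsteinApproximation.apply, mul_comm]
    rw [e, map_sum, evalSum_eq_linearCombination, map_sum, sum_apply]
    refine Finset.sum_congr rfl fun k _ => ?_
    simp [mul_comm]
  choose c hc using h
  refine ⟨c, fun w => ?_⟩
  simp_rw [hc]
  exact (ℓ.continuous.tendsto w).comp (bernsteinApproximation_uniform w)

/-- Pointwise convergence of functionals passes through the characteristic functional by dominated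
convergence. On the Gaussian side norm convergence on L² is needed, and it is deduced from the
characteristic functionals of differences. -/
theorem IsWienerMeasure.charFunDual_eq (hν : IsWienerMeasure ν) (ℓ : StrongDual ℝ C(I, ℝ)) :
    charFunDual ν ℓ = Complex.exp (-((‖ℓ ∘L primitive‖ : ℝ) : ℂ) ^ 2 / 2) := by
  have := hν.isGaussianProcess.isProbabilityMeasure
  obtain ⟨c, hc⟩ := exists_tendsto_evalSum ℓ
  have lim : ∀ {κ : Type} {f : Filter κ} [f.IsCountablyGenerated]
      (L : κ → StrongDual ℝ C(I, ℝ)) (M : StrongDual ℝ C(I, ℝ)),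
      (∀ w, Tendsto (fun k => L k w) f (𝓝 (M w))) →
      Tendsto (fun k => charFunDual ν (L k)) f (𝓝 (charFunDual ν M)) := by
    intro κ f _ L M hL
    simp_rw [charFunDual_apply]
    refine tendsto_integral_filter_of_dominated_convergence (fun _ => 1)
      (Eventually.of_forall fun k => ?_) (Eventually.of_forall fun k =>
        Eventually.of_forall fun w => ?_) (integrable_const _) (Eventually.of_forall fun w => ?_)
    · exact (by fun_prop : Continuous fun w => Complex.exp (L k w * Complex.I)).aestronglyMeasurable
    · rw [Complex.norm_exp_ofReal_mul_I]
    · exact ((Complex.continuous_exp.comp ((Complex.continuous_ofReal).mul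
        continuous_const)).tendsto (M w)).comp (hL w)
  -- The differences tend to 0 pointwise, so exp(−‖·‖²/2) tends to 1; inverting this function
  -- through the logarithm and the square root gives norms tending to 0.
  have hcauchy : CauchySeq fun n => evalSum (c n) ∘L primitive := by
    rw [cauchySeq_iff_tendsto_dist_atTop_0]
    have h1 : Tendsto (fun n : ℕ × ℕ => charFunDual ν (evalSum (c n.1 - c n.2))) atTop
        (𝓝 (charFunDual ν 0)) := by
      refine lim _ 0 fun w => ?_
      simp_rw [evalSum_sub]
      have h2 := ((hc w).comp tendsto_fst).sub ((hc w).comp tendsto_snd)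
      rw [sub_self, prod_atTop_atTop_eq] at h2
      exact h2
    simp_rw [hν.charFunDual_evalSum, evalSum_sub] at h1
    rw [show charFunDual ν 0 = 1 by simp [charFunDual_apply]] at h1
    have h2 := h1.norm
    simp only [Complex.norm_exp] at h2
    have h3 : Tendsto (fun n : ℕ × ℕ => Real.sqrt (-2 * Real.log (Real.exp
        (-‖(evalSum (c n.1) - evalSum (c n.2)) ∘L primitive‖ ^ 2 / 2)))) atTop (𝓝 0) := by
      have h4 : Tendsto (fun n : ℕ × ℕ => Real.exp
        (-‖(evalSum (c n.1) - evalSum (c n.2)) ∘L primitive‖ ^ 2 / 2)) atTop (𝓝 1) := by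
        convert! h2 using 2
        · rw [← Complex.ofReal_pow, ← Complex.ofReal_neg, ← Complex.ofReal_ofNat,
            ← Complex.ofReal_div, Complex.ofReal_re]
        · simp
      have := ((h4.log one_ne_zero).const_mul (-2)).sqrt
      simpa using this
    refine h3.congr fun n => ?_
    rw [Real.log_exp, dist_eq_norm, ContinuousLinearMap.sub_comp,
      show ∀ x : ℝ, -2 * (-x ^ 2 / 2) = x ^ 2 by intro x; ring, Real.sqrt_sq (norm_nonneg _)]
  obtain ⟨T, hT⟩ := cauchySeq_tendsto_of_complete hcauchy
  have hTe : T = ℓ ∘L primitive := by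
    ext h
    refine tendsto_nhds_unique ?_ (hc (primitive h))
    exact ((ContinuousLinearMap.apply ℝ ℝ h).continuous.tendsto T).comp hT
  rw [hTe] at hT
  refine tendsto_nhds_unique (lim _ _ hc) ?_
  simp_rw [hν.charFunDual_evalSum]
  have h5 : Continuous fun x : ℝ => Complex.exp (-(x : ℂ) ^ 2 / 2) := by fun_prop
  exact (h5.tendsto _).comp hT.norm

omit [MeasurableSpace C(I, ℝ)] [BorelSpace C(I, ℝ)] in
theorem norm_comp_embed_sq (ℓ : StrongDual ℝ WW) :
    ‖ℓ ∘L embed‖ ^ 2 = ‖(ℓ ∘L .inl ℝ _ _) ∘L primitive‖ ^ 2 +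
      ‖(ℓ ∘L .inr ℝ _ _) ∘L primitive‖ ^ 2 := by
  set a := (InnerProductSpace.toDual ℝ L2).symm ((ℓ ∘L .inl ℝ _ _) ∘L primitive) with ha
  set b := (InnerProductSpace.toDual ℝ L2).symm ((ℓ ∘L .inr ℝ _ _) ∘L primitive) with hb
  have e : ℓ ∘L embed = innerSL ℝ (WithLp.toLp 2 (a, b) : HH) := by
    ext x
    rw [innerSL_apply_apply, WithLp.prod_inner_apply]
    change _ = inner ℝ a x.fst + inner ℝ b x.snd
    rw [ha, hb, InnerProductSpace.toDual_symm_apply, InnerProductSpace.toDual_symm_apply]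
    change ℓ (primitive x.fst, primitive x.snd) = ℓ (primitive x.fst, 0) + ℓ (0, primitive x.snd)
    rw [← map_add]
    simp
  rw [e, innerSL_apply_norm, WithLp.prod_norm_sq_eq_of_L2]
  change ‖a‖ ^ 2 + ‖b‖ ^ 2 = _
  rw [ha, hb, LinearIsometryEquiv.norm_map, LinearIsometryEquiv.norm_map]

/-- The characteristic functional of a product measure factorizes, and the squared dual norm on the
Hilbert sum is the sum of those on the two summands. -/
theorem IsWienerMeasure.isWienerSpace_embed (hν : IsWienerMeasure ν) :
    IsWienerSpace embed (ν.prod ν) where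
  isProbabilityMeasure := by
    have := hν.isGaussianProcess.isProbabilityMeasure
    infer_instance
  injective := embed_injective
  charFunDual_eq ℓ := by
    have := hν.isGaussianProcess.isProbabilityMeasure
    rw [charFunDual_prod, hν.charFunDual_eq, hν.charFunDual_eq, ← Complex.exp_add,
      ← Complex.ofReal_pow ‖ℓ ∘L embed‖, norm_comp_embed_sq]
    congr 1
    push_cast
    ring

/-- The bilinear form `(x, y) ↦ ⟪x₁, y₂⟫ - ⟪y₁, x₂⟫`. -/
noncomputable def symplecticForm : HH →L[ℝ] HH →L[ℝ] ℝ :=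
  let B : HH →L[ℝ] HH →L[ℝ] ℝ := (innerSL ℝ : L2 →L[ℝ] L2 →L[ℝ] ℝ).bilinearComp
    (WithLp.fstL 2 ℝ L2 L2) (WithLp.sndL 2 ℝ L2 L2)
  B - B.flip

omit [MeasurableSpace C(I, ℝ)] [BorelSpace C(I, ℝ)] in
theorem symplecticForm_apply (x y : HH) :
    symplecticForm x y = inner ℝ x.fst y.snd - inner ℝ y.fst x.snd := rfl

omit [BorelSpace C(I, ℝ)] in
theorem wienerBracket_eq (μ : Measure WW) (F G : WW → ℝ) (w : WW) :
    wienerBracket μ F G w =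
      symplecticForm (malliavinGradient embed μ F w) (malliavinGradient embed μ G w) := by
  rw [symplecticForm_apply, L2.inner_def, L2.inner_def, wienerBracket]
  have e : ∀ a b : ℝ, a * b = inner ℝ a b := fun a b => mul_comm a b
  simp_rw [e]

end ClassicalWiener

end WienerPoisson

theorem mainTheorem1 [MeasurableSpace C(unitInterval, ℝ)] [BorelSpace C(unitInterval, ℝ)]
    (ν : Measure C(unitInterval, ℝ)) (hν : WienerPoisson.IsWienerMeasure ν) :
    WienerPoisson.IsPoissonWienerSpace WienerPoisson.embed (ν.prod ν)
      (WienerPoisson.wienerBracket (ν.prod ν)) := by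
  -- Separability of H is what lets closability pass from vanishing scalar products to a vanishing
  -- vector almost surely.
  have : SecondCountableTopology WienerPoisson.HH :=
    have : Fact ((2 : ℝ≥0∞) ≠ ∞) := ⟨ENNReal.ofNat_ne_top⟩
    have : SecondCountableTopology WienerPoisson.L2 := Lp.SecondCountableTopology
    (WithLp.prodContinuousLinearEquiv 2 ℝ WienerPoisson.L2
      WienerPoisson.L2).toHomeomorph.secondCountableTopology
  exact hν.isWienerSpace_embed.isPoissonWienerSpace WienerPoisson.symplecticForm
    (fun x y => by simp [WienerPoisson.symplecticForm_apply]) (WienerPoisson.wienerBracket_eq _)
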